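/- All algebras are over $\mathbb{C}$ and $\mathbf{i}=\sqrt{-1}$. Let $k,r,m\ge 0$ be integers with $2r\le m$ and $k+r\ge 1$, put $n=2k+1$, and let $\lambda_1,\dots,\lambda_k,\kappa_1,\dots,\kappa_r\in\mathbb{C}^\times$. Let $L=H_{n,m}^{\lambda,\kappa}$ be the twisted Heisenberg superalgebra: the Lie superalgebra with even basis $z_0,u_0,e_1,\widehat{e_1},\dots,e_k,\widehat{e_k}$ and odd basis $w_1,\widehat{w_1},\dots,w_r,\widehat{w_r},\eta_1,\dots,\eta_{m-2r}$, whose nonzero brackets of basis vectors are, up to super skew-symmetry, $[e_i,\widehat{e_i}]=\lambda_i z_0$, $[u_0,e_i]=\lambda_i\widehat{e_i}$, $[u_0,\widehat{e_i}]=-\lambda_i e_i$, $[u_0,w_j]=\kappa_j\widehat{w_j}$, $[u_0,\widehat{w_j}]=-\kappa_j w_j$, $[w_j,w_j]=[\widehat{w_j},\widehat{w_j}]=[\eta_t,\eta_t]=z_0$. Blocks. Let $z,u\in L$ be even, $\alpha\in\mathbb{C}^\times$ and $l\ge 1$. Each block below is a linearly independent family; all brackets among its elements, and of $u$ with its elements,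 that are not listed (and do not follow from the listed ones by super skew-symmetry) are zero. * An even block of type $B^{\mathrm I}_l(u,\alpha)$ is a family of even elements $x_1,y_1,\dots,x_l,y_l$ with $[u,x_i]=-\mathbf{i}\alpha x_{i+1}$, $[u,y_i]=-\mathbf{i}\alpha y_{i+1}$, $[x_i,y_{l-i}]=(-1)^{l-i}\alpha z$ for $1\le i\le l-1$, and $[u,x_l]=-\mathbf{i}\alpha x_1$, $[u,y_l]=-(-1)^l\mathbf{i}\alpha y_1$, $[x_l,y_l]=(-1)^l\alpha z$. * An odd block of type $\overline B^{\mathrm I}_l(u,\alpha)$ is a family of odd elements $x_1,y_1,\dots,x_l,y_l$ with the same brackets with $u$, and with $[x_i,y_{l-i}]=(-1)^{l-i}z$ for $1\le i\le l-1$ and $[x_l,y_l]=(-1)^l z$. * An even block of type $B^{\mathrm{II}}_l(u,\alpha)$ is a family of even elements $x_1,\dots,x_{2l}$ with $[u,x_i]=-\mathbf{i}\alpha x_{i+1}$ (indices modulo $2l$) and $[x_i,x_{2l+1-i}]=(-1)^i\alpha z$ for $1\le i\le 2l$. * An odd block of type $\overline B^{\mathrm{II}}_l(u,\alpha)$ is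 a family of odd elements $y_1,\dots,y_{2l}$ with $[u,y_i]=-\mathbf{i}\alpha y_{i+1}$ and $[y_i,y_{2l-i}]=(-1)^i z$ for $1\le i\le 2l$ (indices modulo $2l$). * A block of type $B^{\mathrm{III}}_{s,p}(u)$ is a family of odd elements $p_1,q_1,\dots,p_s,q_s,z_1,\dots,z_p$ with $[p_i,q_i]=z$ and $[z_j,z_j]=z$. Let $G$ be an abelian group and let $\Gamma: L=\bigoplus_{g\in G}L_g$ be a $G$-grading of the Lie superalgebra $L$, i.e. each $L_g$ is a $\mathbb{Z}/2$-graded subspace and $[L_g,L_h]\subseteq L_{g+h}$. Let $z$ be a nonzero element of the center $Z(L)$. Then there exist an element $u\in L$, homogeneous for $\Gamma$, an integer $l\ge 1$, integers $t,t',q,q',s,p\ge 0$ with $$l(q+q'+2t+2t')+2s+p=n+m-1,\qquad q=q'=0\ \text{ if } l \text{ is odd},$$ and scalars $\beta_1,\dots,\beta_t,\beta_1',\dots,\beta_{t'}',\alpha_1,\dots,\alpha_q,\alpha_1',\dots,\alpha_{q'}'\in\{\pm\lambda_1,\dots,\pm\lambda_k,\pm\kappa_1,\dots,\pm\kappa_r\}$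 such that $\deg u\in G$ has finite order equal to $l$, and $L$ has a basis of elements homogeneous for $\Gamma$ of the form $$\{z,u\}\cup\bigcup_{j=1}^{t}X_j\cup\bigcup_{j=1}^{t'}X_j'\cup\bigcup_{j=1}^{q}Y_j\cup\bigcup_{j=1}^{q'}Y_j'\cup T,$$ where $X_j$ is a block of type $B^{\mathrm I}_l(u,\beta_j)$, $X_j'$ a block of type $\overline B^{\mathrm I}_l(u,\beta_j')$, $Y_j$ a block of type $B^{\mathrm{II}}_{l/2}(u,\alpha_j)$, $Y_j'$ a block of type $\overline B^{\mathrm{II}}_{l/2}(u,\alpha_j')$, $T$ a block of type $B^{\mathrm{III}}_{s,p}(u)$, and the bracket of any two elements belonging to different blocks is zero. -/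

import Mathlib

noncomputable section

/-- The sign `(-1)^{ab}` attached to two parities. -/
def parSign (a b : ZMod 2) : ℂ := if a = 1 ∧ b = 1 then -1 else 1

/-- A (complex) Lie superalgebra: a vector space `L = L₀ ⊕ L₁` with an even bilinear bracket that is
super skew-symmetric and satisfies the super Jacobi identity. -/
class LieSuperalgebra (L : Type*) [AddCommGroup L] [Module ℂ L] where
  /-- `part 0` is the even part, `part 1` is the odd part. -/
  part : ZMod 2 → Submodule ℂ L
  isCompl : IsCompl (part 0) (part 1)
  bracketHom : L →ₗ[ℂ] L →ₗ[ℂ] L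
  bracket_mem : ∀ {a b : ZMod 2} {x y : L}, x ∈ part a → y ∈ part b →
    bracketHom x y ∈ part (a + b)
  skew : ∀ {a b : ZMod 2} {x y : L}, x ∈ part a → y ∈ part b →
    bracketHom x y = -(parSign a b • bracketHom y x)
  jacobi : ∀ {a b c : ZMod 2} {x y w : L}, x ∈ part a → y ∈ part b → w ∈ part c →
    bracketHom x (bracketHom y w) =
      bracketHom (bracketHom x y) w + parSign a b • bracketHom y (bracketHom x w)

namespace LieSuperalgebra

variable {L : Type*} [AddCommGroup L] [Module ℂ L] [LieSuperalgebra L]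

instance instBracketSelf : Bracket L L := ⟨fun x y => bracketHom x y⟩

variable (L) in
/-- The even part `L₀`. -/
abbrev evenPart : Submodule ℂ L := part 0

variable (L) in
/-- The odd part `L₁`. -/
abbrev oddPart : Submodule ℂ L := part 1

variable (L) in
/-- The center `Z(L)`. -/
def center : Set L := {z | ∀ x : L, ⁅z, x⁆ = 0}

/-- `L = ⨁_{g ∈ G} A g` is a grading of the Lie superalgebra `L` by the abelian group `G`:
a decomposition into `ℤ/2`-graded subspaces with `[A g, A h] ⊆ A (g + h)`. -/
structure IsGroupGrading {G : Type*} [AddCommGroup G] [DecidableEq G]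
    (A : G → Submodule ℂ L) : Prop where
  isInternal : DirectSum.IsInternal A
  parity : ∀ g, A g = (A g ⊓ evenPart L) ⊔ (A g ⊓ oddPart L)
  bracket_mem : ∀ {g h : G} {x y : L}, x ∈ A g → y ∈ A h → ⁅x, y⁆ ∈ A (g + h)

/-! Blocks. An index `i : Fin l` stands for the index `i + 1 ∈ {1, …, l}` of the usual notation.
Brackets that follow from the listed ones by super skew-symmetry are not repeated. -/

/-- `{x₁, y₁, …, x_l, y_l}` is a block of type `B_l^I(u, α)` (an even block of type I), where
`x_{i+1} = b (inl i)` and `y_{i+1} = b (inr i)`. -/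
structure IsEvenBlockI (z u : L) (l : ℕ) (α : ℂ) (b : Fin l ⊕ Fin l → L) : Prop where
  z_even : z ∈ evenPart L
  u_even : u ∈ evenPart L
  scalar_ne : α ≠ 0
  even : ∀ i, b i ∈ evenPart L
  indep : LinearIndependent ℂ b
  u_x : ∀ i j : Fin l, (i : ℕ) + 1 = j → ⁅u, b (.inl i)⁆ = (-Complex.I * α) • b (.inl j)
  u_x_last : ∀ i j : Fin l, (i : ℕ) + 1 = l → (j : ℕ) = 0 →
    ⁅u, b (.inl i)⁆ = (-Complex.I * α) • b (.inl j)
  u_y : ∀ i j : Fin l, (i : ℕ) + 1 = j → ⁅u, b (.inr i)⁆ = (-Complex.I * α) • b (.inr j)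
  u_y_last : ∀ i j : Fin l, (i : ℕ) + 1 = l → (j : ℕ) = 0 →
    ⁅u, b (.inr i)⁆ = (-(-1) ^ l * Complex.I * α) • b (.inr j)
  x_x : ∀ i j : Fin l, ⁅b (.inl i), b (.inl j)⁆ = 0
  y_y : ∀ i j : Fin l, ⁅b (.inr i), b (.inr j)⁆ = 0
  x_y : ∀ i j : Fin l, ⁅b (.inl i), b (.inr j)⁆ =
    if ((i : ℕ) + 1) + (j + 1) = l ∨ ((i : ℕ) + 1) + (j + 1) = 2 * l
      then ((-1) ^ ((j : ℕ) + 1) * α) • z else 0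

/-- `{ω₁, ν₁, …, ω_l, ν_l}` is a block of type `\bar B_l^I(u, β)` (an odd block of type I), where
`ω_{i+1} = b (inl i)` and `ν_{i+1} = b (inr i)`. -/
structure IsOddBlockI (z u : L) (l : ℕ) (β : ℂ) (b : Fin l ⊕ Fin l → L) : Prop where
  z_even : z ∈ evenPart L
  u_even : u ∈ evenPart L
  scalar_ne : β ≠ 0
  odd : ∀ i, b i ∈ oddPart L
  indep : LinearIndependent ℂ b
  u_x : ∀ i j : Fin l, (i : ℕ) + 1 = j → ⁅u, b (.inl i)⁆ = (-Complex.I * β) • b (.inl j)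
  u_x_last : ∀ i j : Fin l, (i : ℕ) + 1 = l → (j : ℕ) = 0 →
    ⁅u, b (.inl i)⁆ = (-Complex.I * β) • b (.inl j)
  u_y : ∀ i j : Fin l, (i : ℕ) + 1 = j → ⁅u, b (.inr i)⁆ = (-Complex.I * β) • b (.inr j)
  u_y_last : ∀ i j : Fin l, (i : ℕ) + 1 = l → (j : ℕ) = 0 →
    ⁅u, b (.inr i)⁆ = (-(-1) ^ l * Complex.I * β) • b (.inr j)
  x_x : ∀ i j : Fin l, ⁅b (.inl i), b (.inl j)⁆ = 0
  y_y : ∀ i j : Fin l, ⁅b (.inr i), b (.inr j)⁆ = 0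
  x_y : ∀ i j : Fin l, ⁅b (.inl i), b (.inr j)⁆ =
    if ((i : ℕ) + 1) + (j + 1) = l ∨ ((i : ℕ) + 1) + (j + 1) = 2 * l
      then ((-1) ^ ((j : ℕ) + 1) : ℂ) • z else 0

/-- `{x₁, …, x_{2l}}` is a block of type `B_l^{II}(u, α)` (an even block of type II):
`[u, x_i] = -𝐢 α x_{i+1}` (indices mod `2l`), `[x_i, x_{2l+1-i}] = (-1)^i α z`. -/
structure IsEvenBlockII (z u : L) (l : ℕ) (α : ℂ) (x : Fin (2 * l) → L) : Prop where
  z_even : z ∈ evenPart L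
  u_even : u ∈ evenPart L
  scalar_ne : α ≠ 0
  even : ∀ i, x i ∈ evenPart L
  indep : LinearIndependent ℂ x
  u_x : ∀ i j : Fin (2 * l), (i : ℕ) + 1 = j → ⁅u, x i⁆ = (-Complex.I * α) • x j
  u_x_last : ∀ i j : Fin (2 * l), (i : ℕ) + 1 = 2 * l → (j : ℕ) = 0 →
    ⁅u, x i⁆ = (-Complex.I * α) • x j
  x_x : ∀ i j : Fin (2 * l), ⁅x i, x j⁆ =
    if ((i : ℕ) + 1) + (j + 1) = 2 * l + 1 then ((-1) ^ ((i : ℕ) + 1) * α) • z else 0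

/-- `{y₁, …, y_{2l}}` is a block of type `\bar B_l^{II}(u, β)` (an odd block of type II):
`[u, y_i] = -𝐢 β y_{i+1}` and `[y_i, y_{2l-i}] = (-1)^i z` (indices mod `2l`,
so that `[y_{2l}, y_{2l}] = z`). -/
structure IsOddBlockII (z u : L) (l : ℕ) (β : ℂ) (y : Fin (2 * l) → L) : Prop where
  z_even : z ∈ evenPart L
  u_even : u ∈ evenPart L
  scalar_ne : β ≠ 0
  odd : ∀ i, y i ∈ oddPart L
  indep : LinearIndependent ℂ y
  u_y : ∀ i j : Fin (2 * l), (i : ℕ) + 1 = j → ⁅u, y i⁆ = (-Complex.I * β) • y j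
  u_y_last : ∀ i j : Fin (2 * l), (i : ℕ) + 1 = 2 * l → (j : ℕ) = 0 →
    ⁅u, y i⁆ = (-Complex.I * β) • y j
  y_y : ∀ i j : Fin (2 * l), ⁅y i, y j⁆ =
    if ((i : ℕ) + 1) + (j + 1) = 2 * l ∨ ((i : ℕ) + 1) + (j + 1) = 2 * (2 * l)
      then ((-1) ^ ((i : ℕ) + 1) : ℂ) • z else 0

/-- `{p₁, q₁, …, p_s, q_s, z₁, …, z_p}` is a block of type `B_{s,p}^{III}(u)`, where
`p_{i+1} = b (inl (inl i))`, `q_{i+1} = b (inl (inr i))`, `z_{i+1} = b (inr i)`. -/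
structure IsBlockIII (z u : L) (s p : ℕ) (b : (Fin s ⊕ Fin s) ⊕ Fin p → L) : Prop where
  z_even : z ∈ evenPart L
  u_even : u ∈ evenPart L
  odd : ∀ i, b i ∈ oddPart L
  indep : LinearIndependent ℂ b
  u_b : ∀ i, ⁅u, b i⁆ = 0
  p_q : ∀ i j, ⁅b (.inl (.inl i)), b (.inl (.inr j))⁆ = if i = j then z else 0
  p_p : ∀ i j, ⁅b (.inl (.inl i)), b (.inl (.inl j))⁆ = 0
  q_q : ∀ i j, ⁅b (.inl (.inr i)), b (.inl (.inr j))⁆ = 0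
  pq_z : ∀ i j, ⁅b (.inl i), b (.inr j)⁆ = 0
  z_z : ∀ i j, ⁅b (.inr i), b (.inr j)⁆ = if i = j then z else 0

/-- Labels of the blocks: `t` even and `t'` odd blocks of type I, `q` even and `q'` odd blocks of
type II, and one block of type III. -/
inductive BlockLabel (t t' q q' : ℕ) : Type
  | evenI (j : Fin t)
  | oddI (j : Fin t')
  | evenII (j : Fin q)
  | oddII (j : Fin q')
  | typeIII

/-- The type indexing the elements of the block with the given label. -/
def BlockLabel.Index {t t' q q' : ℕ} (l s p : ℕ) : BlockLabel t t' q q' → Type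
  | .evenI _ => Fin l ⊕ Fin l
  | .oddI _ => Fin l ⊕ Fin l
  | .evenII _ => Fin (2 * (l / 2))
  | .oddII _ => Fin (2 * (l / 2))
  | .typeIII => (Fin s ⊕ Fin s) ⊕ Fin p

/-- The family of all the elements of the given blocks. -/
def blockUnion {l t t' q q' s p : ℕ}
    (X : Fin t → Fin l ⊕ Fin l → L) (X' : Fin t' → Fin l ⊕ Fin l → L)
    (Y : Fin q → Fin (2 * (l / 2)) → L) (Y' : Fin q' → Fin (2 * (l / 2)) → L)
    (T : (Fin s ⊕ Fin s) ⊕ Fin p → L) :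
    (Σ c : BlockLabel t t' q q', c.Index l s p) → L
  | ⟨.evenI j, i⟩ => X j i
  | ⟨.oddI j, i⟩ => X' j i
  | ⟨.evenII j, i⟩ => Y j i
  | ⟨.oddII j, i⟩ => Y' j i
  | ⟨.typeIII, i⟩ => T i

end LieSuperalgebra

/-- Index set of the standard basis
`{z, u, e_i, ê_i | w_j, ŵ_j, η_t}`, `i ≤ k`, `j ≤ r`, `t ≤ d`. -/
inductive TwistedIndex (k r d : ℕ) : Type
  | z
  | u
  | e (i : Fin k)
  | eHat (i : Fin k)
  | w (j : Fin r)
  | wHat (j : Fin r)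
  | eta (t : Fin d)

/-- The underlying space of the twisted Heisenberg superalgebra `H_{n,m}^{λ,κ}`, where
`n = 2k + 1` and `2r ≤ m`. -/
def TwistedHeisenberg (k r m : ℕ) (_lam : Fin k → ℂ) (_kap : Fin r → ℂ) : Type :=
  TwistedIndex k r (m - 2 * r) →₀ ℂ

namespace TwistedHeisenberg

variable {k r m : ℕ} {lam : Fin k → ℂ} {kap : Fin r → ℂ}

instance : AddCommGroup (TwistedHeisenberg k r m lam kap) :=
  inferInstanceAs (AddCommGroup (TwistedIndex k r (m - 2 * r) →₀ ℂ))

instance : Module ℂ (TwistedHeisenberg k r m lam kap) :=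
  inferInstanceAs (Module ℂ (TwistedIndex k r (m - 2 * r) →₀ ℂ))

/-- The standard basis vectors. -/
def std (a : TwistedIndex k r (m - 2 * r)) : TwistedHeisenberg k r m lam kap :=
  Finsupp.single a 1

/-- The brackets of the standard basis vectors. -/
def table : TwistedIndex k r (m - 2 * r) → TwistedIndex k r (m - 2 * r) →
    TwistedHeisenberg k r m lam kap
  | .e i, .eHat j => if i = j then lam i • std .z else 0
  | .eHat i, .e j => if i = j then -(lam i • std .z) else 0
  | .u, .e i => lam i • std (.eHat i)
  | .e i, .u => -(lam i • std (.eHat i))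
  | .u, .eHat i => -(lam i • std (.e i))
  | .eHat i, .u => lam i • std (.e i)
  | .u, .w j => kap j • std (.wHat j)
  | .w j, .u => -(kap j • std (.wHat j))
  | .u, .wHat j => -(kap j • std (.w j))
  | .wHat j, .u => kap j • std (.w j)
  | .w i, .w j => if i = j then std .z else 0
  | .wHat i, .wHat j => if i = j then std .z else 0
  | .eta i, .eta j => if i = j then std .z else 0
  | _, _ => 0

/-- The parity of the standard basis vectors. -/
def parity {d : ℕ} : TwistedIndex k r d → ZMod 2
  | .z => 0
  | .u => 0
  | .e _ => 0
  | .eHat _ => 0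
  | .w _ => 1
  | .wHat _ => 1
  | .eta _ => 1

/-- The bilinear extension of the bracket of the standard basis vectors. -/
def brac : TwistedHeisenberg k r m lam kap →ₗ[ℂ]
    TwistedHeisenberg k r m lam kap →ₗ[ℂ] TwistedHeisenberg k r m lam kap :=
  Finsupp.linearCombination ℂ fun a =>
    (Finsupp.linearCombination ℂ (table a) :
      (TwistedIndex k r (m - 2 * r) →₀ ℂ) →ₗ[ℂ] TwistedHeisenberg k r m lam kap)

/-- The even and the odd part: the spans of the even and of the odd standard basis vectors. -/
def par (a : ZMod 2) : Submodule ℂ (TwistedHeisenberg k r m lam kap) :=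
  Submodule.span ℂ (std '' {i | parity i = a})

theorem brac_std (a b : TwistedIndex k r (m - 2 * r)) :
    brac (std a : TwistedHeisenberg k r m lam kap) (std b) = table a b := by
  have h1 : brac (std a : TwistedHeisenberg k r m lam kap) =
      (Finsupp.linearCombination ℂ (table a) :
        (TwistedIndex k r (m - 2 * r) →₀ ℂ) →ₗ[ℂ] TwistedHeisenberg k r m lam kap) :=
    (Finsupp.linearCombination_single ℂ _ _).trans (one_smul _ _)
  rw [h1]
  exact (Finsupp.linearCombination_single ℂ _ _).trans (one_smul _ _)

theorem std_mem {i : TwistedIndex k r (m - 2 * r)} {a : ZMod 2} (h : parity i = a) :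
    (std i : TwistedHeisenberg k r m lam kap) ∈ par a :=
  Submodule.subset_span ⟨i, h, rfl⟩

theorem table_mem (i j : TwistedIndex k r (m - 2 * r)) :
    (table i j : TwistedHeisenberg k r m lam kap) ∈ par (parity i + parity j) := by
  have h11 : (1 + 1 : ZMod 2) = 0 := by decide
  have hz : (std .z : TwistedHeisenberg k r m lam kap) ∈ par 0 := std_mem rfl
  have he : ∀ i, (std (.e i) : TwistedHeisenberg k r m lam kap) ∈ par 0 := fun _ => std_mem rfl
  have he' : ∀ i, (std (.eHat i) : TwistedHeisenberg k r m lam kap) ∈ par 0 :=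
    fun _ => std_mem rfl
  have hw : ∀ i, (std (.w i) : TwistedHeisenberg k r m lam kap) ∈ par 1 := fun _ => std_mem rfl
  have hw' : ∀ i, (std (.wHat i) : TwistedHeisenberg k r m lam kap) ∈ par 1 :=
    fun _ => std_mem rfl
  have key : ∀ (P : Prop) [Decidable P] (x : TwistedHeisenberg k r m lam kap), x ∈ par 0 →
      (if P then x else 0) ∈ par 0 := by
    intro P _ x hx
    split_ifs
    · exact hx
    · exact Submodule.zero_mem _
  cases i <;> cases j <;> simp only [table, parity, zero_add, add_zero, h11, Submodule.zero_mem]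
  case e.eHat => exact key _ _ (Submodule.smul_mem _ _ hz)
  case eHat.e => exact key _ _ (Submodule.neg_mem _ (Submodule.smul_mem _ _ hz))
  case u.e => exact Submodule.smul_mem _ _ (he' _)
  case e.u => exact Submodule.neg_mem _ (Submodule.smul_mem _ _ (he' _))
  case u.eHat => exact Submodule.neg_mem _ (Submodule.smul_mem _ _ (he _))
  case eHat.u => exact Submodule.smul_mem _ _ (he _)
  case u.w => exact Submodule.smul_mem _ _ (hw' _)
  case w.u => exact Submodule.neg_mem _ (Submodule.smul_mem _ _ (hw' _))
  case u.wHat => exact Submodule.neg_mem _ (Submodule.smul_mem _ _ (hw _))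
  case wHat.u => exact Submodule.smul_mem _ _ (hw _)
  all_goals exact key _ _ hz

theorem table_skew (i j : TwistedIndex k r (m - 2 * r)) :
    (table i j : TwistedHeisenberg k r m lam kap) =
      -(parSign (parity i) (parity j) • table j i) := by
  cases i <;> cases j <;> simp [table, parity, parSign] <;> grind

theorem table_jacobi (i j n : TwistedIndex k r (m - 2 * r)) :
    brac (std i : TwistedHeisenberg k r m lam kap) (table j n) =
      brac (table i j) (std n) +
        parSign (parity i) (parity j) • brac (std j) (table i n) := by
  cases i <;> cases j <;> cases n <;> simp only [table, parity] <;> (try split_ifs) <;>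
    simp [brac_std, table, parSign] <;> grind

theorem isCompl_supported {d : ℕ} :
    IsCompl (Finsupp.supported ℂ ℂ {i : TwistedIndex k r d | parity i = 0})
      (Finsupp.supported ℂ ℂ {i | parity i = 1}) := by
  rw [isCompl_iff]
  constructor
  · refine Finsupp.disjoint_supported_supported (Set.disjoint_left.2 ?_)
    intro i h0 h1
    change parity i = 0 at h0
    change parity i = 1 at h1
    rw [h0] at h1
    exact absurd h1 (by decide)
  · refine Finsupp.codisjoint_supported_supported (codisjoint_iff.2 ?_)
    ext i
    cases i <;> simp [parity]

theorem isCompl_par :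
    IsCompl (par 0 : Submodule ℂ (TwistedHeisenberg k r m lam kap)) (par 1) := by
  have e : ∀ a : ZMod 2, (par a : Submodule ℂ (TwistedHeisenberg k r m lam kap)) =
      Finsupp.supported ℂ ℂ {i | parity i = a} :=
    fun a => (Finsupp.supported_eq_span_single ℂ _).symm
  have h := isCompl_supported (k := k) (r := r) (d := m - 2 * r)
  have e0 := e 0
  have e1 := e 1
  exact (e0.symm ▸ e1.symm ▸ h : _)

instance : LieSuperalgebra (TwistedHeisenberg k r m lam kap) where
  part := par
  isCompl := isCompl_par
  bracketHom := brac
  bracket_mem := by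
    intro a b x y hx hy
    induction hx, hy using Submodule.span_induction₂ with
    | mem_mem x y hx hy =>
      obtain ⟨i, rfl, rfl⟩ := hx
      obtain ⟨j, rfl, rfl⟩ := hy
      rw [brac_std]; exact table_mem i j
    | zero_left => simp
    | zero_right => simp
    | add_left _ _ _ _ _ _ h1 h2 => simpa using Submodule.add_mem _ h1 h2
    | add_right _ _ _ _ _ _ h1 h2 => simpa using Submodule.add_mem _ h1 h2
    | smul_left c _ _ _ _ h => simpa using Submodule.smul_mem _ c h
    | smul_right c _ _ _ _ h => simpa using Submodule.smul_mem _ c h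
  skew := by
    intro a b x y hx hy
    induction hx, hy using Submodule.span_induction₂ with
    | mem_mem x y hx hy =>
      obtain ⟨i, rfl, rfl⟩ := hx
      obtain ⟨j, rfl, rfl⟩ := hy
      rw [brac_std, brac_std]; exact table_skew i j
    | zero_left => simp
    | zero_right => simp
    | add_left _ _ _ _ _ _ h1 h2 => simp only [map_add, LinearMap.add_apply, h1, h2]; module
    | add_right _ _ _ _ _ _ h1 h2 => simp only [map_add, LinearMap.add_apply, h1, h2]; module
    | smul_left c _ _ _ _ h => simp only [map_smul, LinearMap.smul_apply, h]; module
    | smul_right c _ _ _ _ h => simp only [map_smul, LinearMap.smul_apply, h]; module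
  jacobi := by
    intro a b c x y w hx hy hw
    induction hx, hy using Submodule.span_induction₂ with
    | mem_mem x y hx hy =>
      obtain ⟨i, rfl, rfl⟩ := hx
      obtain ⟨j, rfl, rfl⟩ := hy
      induction hw using Submodule.span_induction with
      | mem w hw =>
        obtain ⟨n, rfl, rfl⟩ := hw
        rw [brac_std, brac_std, brac_std]; exact table_jacobi i j n
      | zero => simp
      | add _ _ _ _ h1 h2 => simp only [map_add, h1, h2]; module
      | smul c _ _ h => simp only [map_smul, h]; module
    | zero_left => simp
    | zero_right => simp
    | add_left _ _ _ _ _ _ h1 h2 => simp only [map_add, LinearMap.add_apply, h1, h2]; module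
    | add_right _ _ _ _ _ _ h1 h2 => simp only [map_add, LinearMap.add_apply, h1, h2]; module
    | smul_left c _ _ _ _ h => simp only [map_smul, LinearMap.smul_apply, h]; module
    | smul_right c _ _ _ _ h => simp only [map_smul, LinearMap.smul_apply, h]; module

end TwistedHeisenberg

/-- The set `{±λ₁, …, ±λ_k, ±κ₁, …, ±κ_r}`. -/
def signedScalars {k r : ℕ} (lam : Fin k → ℂ) (kap : Fin r → ℂ) : Set ℂ :=
  {c | (∃ i, c = lam i ∨ c = -lam i) ∨ (∃ j, c = kap j ∨ c = -kap j)}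

end

/-! The even part is spanned by homogeneous even vectors, so one of them, rescaled, has
`u₀`-coordinate 1; this is u, of degree h say. Put T = ad u. On the Heisenberg ideal (the vectors of
`u₀`-coordinate 0) T differs from ad u₀ only by multiples of the central z₀. Hence T is
diagonalizable on L with eigenvalues among 0 and -iα, α a signed scalar. The space V = T(L) + L₁ is
graded, T-stable and complementary to ⟨z, u⟩, and on it the bracket is ω(x, y) z for a nondegenerate
form ω.

The order l of h is finite: L has only finitely many degrees, so otherwise T would be nilpotent on
homogeneous vectors, and, being diagonalizable, zero. Thus T^l preserves degrees, and V is spanned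
by vectors lying in components: given degree g, parity a and T^l-eigenvalue μ. Since T is a
derivation killing z, ω(Tx, y) = -ω(x, Ty); so the component (g, a, μ) pairs nontrivially only with
(deg z - g, a, (-1)^l μ).

Take x, y in components with ω(x, y) ≠ 0. If Tx = 0, then Ty = 0 and both are odd; they yield a pair
{p, q} or a single element of the type III block. Otherwise μ = (-iα)^l, and with c = -iα the
rescaled orbits c⁻ⁱTⁱx, c⁻ⁱTⁱy have period l up to sign. For reasons of degree ω(x, Tⁿy) vanishes
unless l divides n. If x and y are each orthogonal to their own orbit, the two orbits form a block
of type I. If ω(x, Tⁿx) ≠ 0 for some n, then l is even, and replacing x by T^⌊n/2⌋x reduces to n = 0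
or n = 1; super skew-symmetry forces odd parity in the first case and even parity in the second, and
the single orbit is a block of type II (`exists_blockII`); likewise for y.

The span of a block is homogeneous, T-stable and nondegenerate for ω, so its orthogonal complement
in V inherits all hypotheses (`exists_complement`), and induction exhausts V (`exists_blocks`).
Linear independence comes from a dual partner for every block vector (`DualFamily`), and the
identity between the numbers of blocks is a count of dimensions. -/

noncomputable section

/-! ### Parity and even derivations in a Lie superalgebra -/

namespace LieSuperalgebra

variable {L : Type*} [AddCommGroup L] [Module ℂ L] [LieSuperalgebra L]

theorem lie_eq_bracketHom (x y : L) : ⁅x, y⁆ = bracketHom x y := rfl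

theorem exists_even_add_odd (x : L) : ∃ a ∈ evenPart L, ∃ b ∈ oddPart L, a + b = x :=
  Submodule.mem_sup.1 ((isCompl (L := L)).sup_eq_top ▸ Submodule.mem_top)

theorem eq_zero_of_mem_even_of_mem_odd {x : L} (h0 : x ∈ evenPart L) (h1 : x ∈ oddPart L) :
    x = 0 :=
  (Submodule.disjoint_def.1 (isCompl (L := L)).disjoint) x h0 h1

theorem eq_zero_of_mem_part {a b : ZMod 2} (hab : a ≠ b) {x : L} (h0 : x ∈ part a)
    (h1 : x ∈ part b) : x = 0 := by
  fin_cases a <;> fin_cases b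
  · exact absurd rfl hab
  · exact eq_zero_of_mem_even_of_mem_odd h0 h1
  · exact eq_zero_of_mem_even_of_mem_odd h1 h0
  · exact absurd rfl hab

theorem even_bracket_mem {u x : L} {a : ZMod 2} (hu : u ∈ evenPart L) (hx : x ∈ part a) :
    bracketHom u x ∈ (part a : Submodule ℂ L) := by
  simpa using bracket_mem hu hx

/-- An even element acts by a derivation. -/
theorem even_bracket_bracket {u : L} (hu : u ∈ evenPart L) (x y : L) :
    bracketHom u (bracketHom x y) =
      bracketHom (bracketHom u x) y + bracketHom x (bracketHom u y) := by
  have key : ∀ a b : ZMod 2, ∀ x ∈ (part a : Submodule ℂ L), ∀ y ∈ (part b : Submodule ℂ L),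
      bracketHom u (bracketHom x y) =
        bracketHom (bracketHom u x) y + bracketHom x (bracketHom u y) := by
    intro a b x hx y hy
    have := jacobi hu hx hy
    simpa [parSign] using this
  obtain ⟨x0, hx0, x1, hx1, rfl⟩ := exists_even_add_odd x
  obtain ⟨y0, hy0, y1, hy1, rfl⟩ := exists_even_add_odd y
  simp only [map_add, LinearMap.add_apply, key _ _ _ hx0 _ hy0, key _ _ _ hx0 _ hy1,
    key _ _ _ hx1 _ hy0, key _ _ _ hx1 _ hy1]
  abel

theorem lie_eq_zero_symm {a b : ZMod 2} {x y : L} (hx : x ∈ part a) (hy : y ∈ part b)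
    (h : ⁅x, y⁆ = 0) : ⁅y, x⁆ = 0 := by
  have := skew hy hx
  rw [lie_eq_bracketHom] at h ⊢
  rw [this, h, smul_zero, neg_zero]

/-! ### Dual families and independence of blocks -/

/-- A family with a dual: every member has a partner which brackets nontrivially with it and
trivially with the other members. -/
def DualFamily {ι : Type*} (b : ι → L) : Prop :=
  ∀ i, ∃ j, ⁅b i, b j⁆ ≠ 0 ∧ ∀ i', i' ≠ i → ⁅b i', b j⁆ = 0

/-- Bracketing a linear relation with the partner of `b i` leaves only the coefficient of `b i`. The
same partners later give the projection along a block. -/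
theorem DualFamily.linearIndependent {ι : Type*} {b : ι → L} (hb : DualFamily b) :
    LinearIndependent ℂ b := by
  classical
  rw [linearIndependent_iff']
  intro s c hc i hi
  obtain ⟨j, hj, hj'⟩ := hb i
  have h := congrArg (fun x => bracketHom x (b j)) hc
  simp only [map_sum, LinearMap.sum_apply, map_smul, LinearMap.smul_apply, map_zero,
    LinearMap.zero_apply] at h
  rw [Finset.sum_eq_single i] at h
  · exact (smul_eq_zero.1 h).resolve_right hj
  · intro i' _ hi'
    have := hj' i' hi'
    rw [lie_eq_bracketHom] at this
    rw [this, smul_zero]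
  · exact fun h => absurd hi h

theorem dualFamily_blockI {z : L} (hz : z ≠ 0) {l : ℕ} {b : Fin l ⊕ Fin l → L} {a : ZMod 2}
    (hb : ∀ i, b i ∈ part a) {σ : ℕ → ℂ} (hσ : ∀ n, σ n ≠ 0)
    (x_x : ∀ i j : Fin l, ⁅b (.inl i), b (.inl j)⁆ = 0)
    (y_y : ∀ i j : Fin l, ⁅b (.inr i), b (.inr j)⁆ = 0)
    (x_y : ∀ i j : Fin l, ⁅b (.inl i), b (.inr j)⁆ =
      if ((i : ℕ) + 1) + (j + 1) = l ∨ ((i : ℕ) + 1) + (j + 1) = 2 * l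
        then σ j • z else 0) : DualFamily b := by
  have partner : ∀ i : Fin l, ∃ j : Fin l,
      ((i : ℕ) + 1 + (j + 1) = l ∨ (i : ℕ) + 1 + (j + 1) = 2 * l) ∧
      ∀ i' : Fin l, ((i' : ℕ) + 1 + (j + 1) = l ∨ (i' : ℕ) + 1 + (j + 1) = 2 * l) → i' = i := by
    intro i
    -- In the usual numbering x_l is paired with y_l, and x_i with y_{l-i} for i < l; with indices
    -- starting at 0 the latter partner is `l - 2 - i`.
    by_cases hi : (i : ℕ) + 1 = l
    · refine ⟨i, Or.inr (by omega), fun i' h => Fin.ext (by omega)⟩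
    · refine ⟨⟨l - 2 - i, by omega⟩, Or.inl ?_, fun i' h => Fin.ext ?_⟩
      · simp only; omega
      · simp only at h; omega
  have hne : ∀ i j : Fin l, ⁅b (.inl i), b (.inr j)⁆ ≠ 0 ↔
      ((i : ℕ) + 1 + (j + 1) = l ∨ (i : ℕ) + 1 + (j + 1) = 2 * l) := by
    intro i j
    rw [x_y]
    split_ifs with h
    · simp [hz, hσ, h]
    · simp [h]
  rintro (i | i)
  · obtain ⟨j, hj, hj'⟩ := partner i
    refine ⟨.inr j, (hne i j).2 hj, ?_⟩
    rintro (i' | i') hi'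
    · by_contra h
      exact hi' (congrArg _ (hj' i' ((hne i' j).1 h)))
    · exact y_y _ _
  · obtain ⟨j, hj, hj'⟩ := partner i
    refine ⟨.inl j, fun h => (hne j i).2 (by omega) (lie_eq_zero_symm (hb _) (hb _) h), ?_⟩
    rintro (i' | i') hi'
    · exact x_x _ _
    · refine lie_eq_zero_symm (hb _) (hb _) ?_
      by_contra h
      have := (hne j i').1 h
      exact hi' (congrArg _ (hj' i' (by omega)))

theorem dualFamily_of_partner {z : L} (hz : z ≠ 0) {ι : Type*} {b : ι → L} {P : ι → ι → Prop}
    [∀ i j, Decidable (P i j)] (hP : ∀ i, ∃ j, P i j ∧ ∀ i', P i' j → i' = i) {σ : ι → ℂ}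
    (hσ : ∀ n, σ n ≠ 0) (hb : ∀ i j, ⁅b i, b j⁆ = if P i j then σ i • z else 0) :
    DualFamily b := by
  intro i
  obtain ⟨j, hj, hj'⟩ := hP i
  refine ⟨j, ?_, fun i' hi' => ?_⟩
  · rw [hb, if_pos hj]
    exact smul_ne_zero (hσ i) hz
  · rw [hb, if_neg fun h => hi' (hj' i' h)]

theorem dualFamily_blockII_even {z : L} (hz : z ≠ 0) {n : ℕ} {b : Fin n → L}
    {σ : Fin n → ℂ} (hσ : ∀ n, σ n ≠ 0)
    (hb : ∀ i j : Fin n, ⁅b i, b j⁆ =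
      if ((i : ℕ) + 1) + (j + 1) = n + 1 then σ i • z else 0) : DualFamily b := by
  refine dualFamily_of_partner hz (fun i => ⟨⟨n - 1 - i, by omega⟩, ?_, fun i' h => Fin.ext ?_⟩)
    hσ hb
  · simp only; omega
  · simp only at h; omega

theorem dualFamily_blockII_odd {z : L} (hz : z ≠ 0) {n : ℕ} {b : Fin n → L}
    {σ : Fin n → ℂ} (hσ : ∀ n, σ n ≠ 0)
    (hb : ∀ i j : Fin n, ⁅b i, b j⁆ =
      if ((i : ℕ) + 1) + (j + 1) = n ∨ ((i : ℕ) + 1) + (j + 1) = 2 * n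
        then σ i • z else 0) : DualFamily b := by
  refine dualFamily_of_partner hz (fun i => ?_) hσ hb
  by_cases hi : (i : ℕ) + 1 = n
  · exact ⟨i, Or.inr (by omega), fun i' h => Fin.ext (by omega)⟩
  · refine ⟨⟨n - 2 - i, by omega⟩, Or.inl ?_, fun i' h => Fin.ext ?_⟩
    · simp only; omega
    · simp only at h; omega

theorem IsEvenBlockI.dualFamily {z u : L} (hz : z ≠ 0) {l : ℕ} {α : ℂ} {b : Fin l ⊕ Fin l → L}
    (h : IsEvenBlockI z u l α b) : DualFamily b :=
  dualFamily_blockI hz (σ := fun j => (-1) ^ (j + 1) * α) h.even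
    (fun n => mul_ne_zero (pow_ne_zero _ (by norm_num)) h.scalar_ne) h.x_x h.y_y h.x_y

theorem IsOddBlockI.dualFamily {z u : L} (hz : z ≠ 0) {l : ℕ} {α : ℂ} {b : Fin l ⊕ Fin l → L}
    (h : IsOddBlockI z u l α b) : DualFamily b :=
  dualFamily_blockI hz (σ := fun j => (-1) ^ (j + 1)) h.odd
    (fun n => pow_ne_zero _ (by norm_num)) h.x_x h.y_y h.x_y

theorem IsEvenBlockII.dualFamily {z u : L} (hz : z ≠ 0) {l : ℕ} {α : ℂ} {b : Fin (2 * l) → L}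
    (h : IsEvenBlockII z u l α b) : DualFamily b :=
  dualFamily_blockII_even hz (σ := fun j => (-1) ^ ((j : ℕ) + 1) * α)
    (fun n => mul_ne_zero (pow_ne_zero _ (by norm_num)) h.scalar_ne) h.x_x

theorem IsOddBlockII.dualFamily {z u : L} (hz : z ≠ 0) {l : ℕ} {α : ℂ} {b : Fin (2 * l) → L}
    (h : IsOddBlockII z u l α b) : DualFamily b :=
  dualFamily_blockII_odd hz (σ := fun j => (-1) ^ ((j : ℕ) + 1))
    (fun n => pow_ne_zero _ (by norm_num)) h.y_y

theorem dualFamily_blockIII {z : L} (hz : z ≠ 0) {s p : ℕ} {b : (Fin s ⊕ Fin s) ⊕ Fin p → L}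
    (hb : ∀ i, b i ∈ oddPart L)
    (p_q : ∀ i j, ⁅b (.inl (.inl i)), b (.inl (.inr j))⁆ = if i = j then z else 0)
    (p_p : ∀ i j, ⁅b (.inl (.inl i)), b (.inl (.inl j))⁆ = 0)
    (q_q : ∀ i j, ⁅b (.inl (.inr i)), b (.inl (.inr j))⁆ = 0)
    (pq_z : ∀ i j, ⁅b (.inl i), b (.inr j)⁆ = 0)
    (z_z : ∀ i j, ⁅b (.inr i), b (.inr j)⁆ = if i = j then z else 0) : DualFamily b := by
  have sym : ∀ i j, ⁅b i, b j⁆ = 0 → ⁅b j, b i⁆ = 0 :=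
    fun i j h => lie_eq_zero_symm (hb i) (hb j) h
  rintro ((i | i) | i)
  · refine ⟨.inl (.inr i), by simpa [p_q] using hz, ?_⟩
    rintro ((j | j) | j) hj
    · rw [p_q, if_neg (by rintro rfl; exact hj rfl)]
    · exact q_q _ _
    · exact sym _ _ (pq_z _ _)
  · refine ⟨.inl (.inl i), fun h => hz (by simpa [p_q] using sym _ _ h), ?_⟩
    rintro ((j | j) | j) hj
    · exact p_p _ _
    · refine sym _ _ ?_
      rw [p_q, if_neg (by rintro rfl; exact hj rfl)]
    · exact sym _ _ (pq_z _ _)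
  · refine ⟨.inr i, by simpa [z_z] using hz, ?_⟩
    rintro (j | j) hj
    · exact pq_z _ _
    · rw [z_z, if_neg (by rintro rfl; exact hj rfl)]

end LieSuperalgebra

/-! ### Rescaled orbits of an operator -/

/-- The rescaled orbit `c⁻ⁿ Tⁿ x`. -/
def scaledOrbit {M : Type*} [AddCommGroup M] [Module ℂ M] (T : Module.End ℂ M) (c : ℂ) (x : M)
    (n : ℕ) : M := (c⁻¹) ^ n • (T ^ n) x

section scaledOrbit

variable {M : Type*} [AddCommGroup M] [Module ℂ M] (T : Module.End ℂ M) {c : ℂ} (hc : c ≠ 0) (x : M)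

include hc

theorem map_scaledOrbit (n : ℕ) :
    T (scaledOrbit T c x n) = c • scaledOrbit T c x (n + 1) := by
  simp only [scaledOrbit, map_smul, smul_smul, pow_succ' T n, Module.End.mul_apply]
  congr 1
  rw [pow_succ', mul_inv_cancel_left₀ hc]

/-- Periodicity up to the factor ε, which is 1 for the orbit of x and (-1)^l for that of y in a
block of type I. -/
theorem scaledOrbit_add {l : ℕ} {ε : ℂ} (hx : (T ^ l) x = (ε * c ^ l) • x) (n : ℕ) :
    scaledOrbit T c x (n + l) = ε • scaledOrbit T c x n := by
  simp only [scaledOrbit, pow_add, Module.End.mul_apply, hx, map_smul, smul_smul]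
  congr 1
  rw [inv_pow c l]
  field_simp

end scaledOrbit

/-! ### The form ω and its behaviour on components -/

namespace LieSuperalgebra

variable {L : Type*} [AddCommGroup L] [Module ℂ L] [LieSuperalgebra L]

/-- The data from which blocks are split off: a graded subspace `V`, stable under the homogeneous
derivation `ad u`, on which the bracket is a form `ω` with values in the line spanned by `z`. -/
structure BlockSetting {G : Type*} [AddCommGroup G] (A : G → Submodule ℂ L) (z u : L) (h gz : G)
    (l : ℕ) (Sc : Set ℂ) (V : Submodule ℂ L) (ω : L →ₗ[ℂ] L →ₗ[ℂ] ℂ) : Prop where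
  z_even : z ∈ evenPart L
  u_even : u ∈ evenPart L
  z_ne : z ≠ 0
  u_z : bracketHom u z = 0
  l_pos : 0 < l
  order : addOrderOf h = l
  scal_ne : ∀ α ∈ Sc, α ≠ 0
  T_mem : ∀ x ∈ V, bracketHom u x ∈ V
  T_deg : ∀ g, ∀ x ∈ A g, bracketHom u x ∈ A (h + g)
  lie_eq : ∀ x ∈ V, ∀ y ∈ V, bracketHom x y = ω x y • z
  ω_deg : ∀ g g', ∀ x ∈ V, ∀ y ∈ V, x ∈ A g → y ∈ A g' → ω x y ≠ 0 → g + g' = gz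
  T_ker : ∀ x ∈ V, x ∈ evenPart L → bracketHom u x = 0 → x = 0
  T_pow : ∀ x ∈ V, x ≠ 0 → ∀ μ : ℂ, ((bracketHom u : Module.End ℂ L) ^ l) x = μ • x →
    bracketHom u x = 0 ∨ ∃ α ∈ Sc, μ = (-Complex.I * α) ^ l

/-- The vectors of degree `g` and parity `a` on which `(ad u)^l` acts by `μ`. -/
def component {G : Type*} (A : G → Submodule ℂ L) (u : L) (l : ℕ) (j : G × ZMod 2 × ℂ) :
    Submodule ℂ L :=
  A j.1 ⊓ part j.2.1 ⊓ Module.End.eigenspace ((bracketHom u : Module.End ℂ L) ^ l) j.2.2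

theorem mem_component {G : Type*} {A : G → Submodule ℂ L} {u : L} {l : ℕ} {g : G} {a : ZMod 2}
    {μ : ℂ} {x : L} : x ∈ component A u l (g, a, μ) ↔
      x ∈ A g ∧ x ∈ (part a : Submodule ℂ L) ∧
        ((bracketHom u : Module.End ℂ L) ^ l) x = μ • x := by
  simp [component, and_assoc]

namespace BlockSetting

variable {G : Type*} [AddCommGroup G] {A : G → Submodule ℂ L} {z u : L} {h gz : G}
    {l : ℕ} {Sc : Set ℂ} {V : Submodule ℂ L} {ω : L →ₗ[ℂ] L →ₗ[ℂ] ℂ}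
    (S : BlockSetting A z u h gz l Sc V ω)

include S

theorem T_pow_mem {x : L} (hx : x ∈ V) (n : ℕ) :
    ((bracketHom u : Module.End ℂ L) ^ n) x ∈ V := by
  induction n with
  | zero => simpa using hx
  | succ n ih => rw [pow_succ', Module.End.mul_apply]; exact S.T_mem _ ih

theorem component_T {j : G × ZMod 2 × ℂ} {x : L} (hx : x ∈ component A u l j) :
    bracketHom u x ∈ component A u l (h + j.1, j.2) := by
  obtain ⟨g, a, μ⟩ := j
  rw [mem_component] at hx ⊢
  refine ⟨S.T_deg _ _ hx.1, even_bracket_mem S.u_even hx.2.1, ?_⟩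
  rw [← Module.End.mul_apply, ← pow_succ, pow_succ', Module.End.mul_apply, hx.2.2, map_smul]

theorem component_T_pow {j : G × ZMod 2 × ℂ} {x : L} (hx : x ∈ component A u l j) (n : ℕ) :
    ((bracketHom u : Module.End ℂ L) ^ n) x ∈ component A u l (n • h + j.1, j.2) := by
  obtain ⟨g, c⟩ := j
  induction n with
  | zero =>
    simp only [pow_zero, Module.End.one_apply, zero_nsmul, zero_add]
    exact hx
  | succ n ih =>
    rw [pow_succ', Module.End.mul_apply, succ_nsmul', add_assoc]
    have := S.component_T ih
    exact this

/-- Apply the derivation ad u to [x, y] = ω(x, y) z: the left side vanishes because [u, z] = 0. -/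
theorem ω_T {x y : L} (hx : x ∈ V) (hy : y ∈ V) :
    ω (bracketHom u x) y = -ω x (bracketHom u y) := by
  have := even_bracket_bracket S.u_even x y
  rw [S.lie_eq x hx y hy, S.lie_eq _ (S.T_mem x hx) y hy, S.lie_eq x hx _ (S.T_mem y hy),
    map_smul, S.u_z, smul_zero, ← add_smul] at this
  exact eq_neg_of_add_eq_zero_left ((smul_eq_zero.1 this.symm).resolve_right S.z_ne)

theorem ω_T_pow {x y : L} (hx : x ∈ V) (hy : y ∈ V) (n : ℕ) :
    ω (((bracketHom u : Module.End ℂ L) ^ n) x) y =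
      (-1) ^ n * ω x (((bracketHom u : Module.End ℂ L) ^ n) y) := by
  induction n generalizing y with
  | zero => simp
  | succ n ih =>
    rw [pow_succ', Module.End.mul_apply, S.ω_T (S.T_pow_mem hx n) hy, ih (S.T_mem y hy),
      ← Module.End.mul_apply, ← pow_succ, pow_succ', pow_succ']
    ring

theorem ω_skew {x y : L} (hx : x ∈ V) (hy : y ∈ V) {a : ZMod 2} (hxa : x ∈ part a)
    (hya : y ∈ part a) : ω x y = -(parSign a a * ω y x) := by
  have := skew hxa hya
  rw [S.lie_eq x hx y hy, S.lie_eq y hy x hx, smul_smul, ← neg_smul] at this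
  exact smul_left_injective ℂ S.z_ne this

theorem ω_part {x y : L} (hx : x ∈ V) (hy : y ∈ V) {a b : ZMod 2} (hxa : x ∈ part a)
    (hyb : y ∈ part b) (hω : ω x y ≠ 0) : b = a := by
  by_contra hab
  have h1 : a + b ≠ 0 :=
    (by decide : ∀ a b : ZMod 2, ¬ b = a → a + b ≠ 0) a b hab
  have h2 := bracket_mem hxa hyb
  rw [S.lie_eq x hx y hy] at h2
  exact smul_ne_zero hω S.z_ne
    (eq_zero_of_mem_part h1 h2 (Submodule.smul_mem _ _ S.z_even))

/-- Components pair nontrivially only with the opposite component. -/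
theorem ω_component {x y : L} (hx : x ∈ V) (hy : y ∈ V) {g g' : G} {a a' : ZMod 2} {μ μ' : ℂ}
    (hxc : x ∈ component A u l (g, a, μ)) (hyc : y ∈ component A u l (g', a', μ'))
    (hω : ω x y ≠ 0) : g + g' = gz ∧ a' = a ∧ μ = (-1) ^ l * μ' := by
  rw [mem_component] at hxc hyc
  refine ⟨S.ω_deg g g' x hx y hy hxc.1 hyc.1 hω, S.ω_part hx hy hxc.2.1 hyc.2.1 hω, ?_⟩
  -- Moving T^l across ω costs (-1)^l, so μ ω(x, y) = (-1)^l μ' ω(x, y).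
  have := S.ω_T_pow hx hy l
  rw [hxc.2.2, hyc.2.2, map_smul, map_smul, LinearMap.smul_apply, smul_eq_mul, smul_eq_mul,
    ← mul_assoc] at this
  exact mul_right_cancel₀ hω this

/-- A component has only one opposite component. This is what makes the projection along a block
respect components. -/
theorem component_eq {x x' y : L} (hx : x ∈ V) (hx' : x' ∈ V) (hy : y ∈ V)
    {i i' j : G × ZMod 2 × ℂ} (hxc : x ∈ component A u l i) (hxc' : x' ∈ component A u l i')
    (hyc : y ∈ component A u l j) (hω : ω x y ≠ 0) (hω' : ω x' y ≠ 0) : i = i' := by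
  obtain ⟨g, a, μ⟩ := i
  obtain ⟨g', a', μ'⟩ := i'
  obtain ⟨k, b, ν⟩ := j
  obtain ⟨h1, h2, h3⟩ := S.ω_component hx hy hxc hyc hω
  obtain ⟨h1', h2', h3'⟩ := S.ω_component hx' hy hxc' hyc hω'
  rw [add_right_cancel (h1.trans h1'.symm), ← h2, ← h2', h3, h3']

theorem scaledOrbit_mem {x : L} (hx : x ∈ V) (c : ℂ) (n : ℕ) :
    scaledOrbit (bracketHom u) c x n ∈ V :=
  Submodule.smul_mem _ _ (S.T_pow_mem hx n)

/-- All powers of T are moved onto y, so every bracket inside a block reduces to a value ω(x, Tⁿy).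
-/
theorem lie_scaledOrbit {x y : L} (hx : x ∈ V) (hy : y ∈ V) (c : ℂ) (m n : ℕ) :
    ⁅scaledOrbit (bracketHom u) c x m, scaledOrbit (bracketHom u) c y n⁆ =
      ((-1) ^ m * (c⁻¹) ^ (m + n) *
        ω x (((bracketHom u : Module.End ℂ L) ^ (m + n)) y)) • z := by
  rw [lie_eq_bracketHom, S.lie_eq _ (S.scaledOrbit_mem hx c m) _ (S.scaledOrbit_mem hy c n)]
  congr 1
  simp only [scaledOrbit, map_smul, LinearMap.smul_apply, smul_eq_mul]
  rw [S.ω_T_pow hx (S.T_pow_mem hy n), ← Module.End.mul_apply, ← pow_add]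
  ring

/-- If `n` and `e` both gave the degree of z, then (n - e)h = 0, so l would divide n - e. Blocks of
type I and odd blocks of type II use e = 0, even blocks of type II use e = 1. -/
theorem ω_T_pow_eq_zero {x y : L} (hx : x ∈ V) (hy : y ∈ V) {g g' : G} (hxg : x ∈ A g)
    (hT : ∀ n, ((bracketHom u : Module.End ℂ L) ^ n) y ∈ A (n • h + g'))
    {e n : ℕ} (he : g + (e • h + g') = gz) (hn : ¬ (l : ℤ) ∣ (n : ℤ) - e) :
    ω x (((bracketHom u : Module.End ℂ L) ^ n) y) = 0 := by
  by_contra hω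
  have h1 := S.ω_deg _ _ x hx _ (S.T_pow_mem hy n) hxg (hT n) hω
  rw [← he] at h1
  have h2 : n • h = e • h := add_right_cancel (add_left_cancel h1)
  apply hn
  rw [← S.order, addOrderOf_dvd_iff_zsmul_eq_zero, sub_zsmul, natCast_zsmul, natCast_zsmul, h2]
  simp

end BlockSetting
end LieSuperalgebra

/-! ### Blocks built from orbits -/

namespace LieSuperalgebra

variable {L : Type*} [AddCommGroup L] [Module ℂ L] [LieSuperalgebra L]

/-- A block of type I or II, or one of the constituents `{p, q}`, `{x}` of a block of type III. -/
inductive Block (L : Type*) (l : ℕ) : Type _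
  | evenI (d : ℂ × (Fin l ⊕ Fin l → L))
  | oddI (d : ℂ × (Fin l ⊕ Fin l → L))
  | evenII (d : ℂ × (Fin (2 * (l / 2)) → L))
  | oddII (d : ℂ × (Fin (2 * (l / 2)) → L))
  | pair (d : L × L)
  | single (x : L)

/-- The defining relations of a block. -/
def Block.IsBlock (z u : L) {l : ℕ} (Sc : Set ℂ) : Block L l → Prop
  | .evenI d => d.1 ∈ Sc ∧ IsEvenBlockI z u l d.1 d.2
  | .oddI d => d.1 ∈ Sc ∧ IsOddBlockI z u l d.1 d.2
  | .evenII d => Even l ∧ d.1 ∈ Sc ∧ IsEvenBlockII z u (l / 2) d.1 d.2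
  | .oddII d => Even l ∧ d.1 ∈ Sc ∧ IsOddBlockII z u (l / 2) d.1 d.2
  | .pair d => d.1 ∈ oddPart L ∧ d.2 ∈ oddPart L ∧ ⁅u, d.1⁆ = 0 ∧ ⁅u, d.2⁆ = 0 ∧
      ⁅d.1, d.2⁆ = z ∧ ⁅d.1, d.1⁆ = 0 ∧ ⁅d.2, d.2⁆ = 0
  | .single x => x ∈ oddPart L ∧ ⁅u, x⁆ = 0 ∧ ⁅x, x⁆ = z

/-- The elements of a block. -/
def Block.elems {l : ℕ} : Block L l → Set L
  | .evenI d => Set.range d.2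
  | .oddI d => Set.range d.2
  | .evenII d => Set.range d.2
  | .oddII d => Set.range d.2
  | .pair d => {d.1, d.2}
  | .single x => {x}

theorem Block.IsBlock.exists_dualFamily {z u : L} (hz : z ≠ 0) {l : ℕ} {Sc : Set ℂ}
    {B : Block L l} (hB : B.IsBlock z u Sc) :
    ∃ (ι : Type) (_ : Fintype ι) (b : ι → L), Set.range b = B.elems ∧ DualFamily b := by
  rcases B with d | d | d | d | d | x
  · exact ⟨_, inferInstance, d.2, rfl, hB.2.dualFamily hz⟩
  · exact ⟨_, inferInstance, d.2, rfl, hB.2.dualFamily hz⟩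
  · exact ⟨_, inferInstance, d.2, rfl, hB.2.2.dualFamily hz⟩
  · exact ⟨_, inferInstance, d.2, rfl, hB.2.2.dualFamily hz⟩
  · obtain ⟨h1, h2, -, -, h5, h6, h7⟩ := hB
    refine ⟨Bool, inferInstance, fun i => if i then d.1 else d.2, ?_, fun i => ⟨!i, ?_, ?_⟩⟩
    · ext y
      simp [Block.elems, or_comm]
    · have : ⁅d.2, d.1⁆ ≠ 0 := fun h => hz (h5 ▸ lie_eq_zero_symm h2 h1 h)
      cases i <;> simp [h5, hz, this]
    · cases i <;> simp [h6, h7]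
  · obtain ⟨-, -, h3⟩ := hB
    exact ⟨Unit, inferInstance, fun _ => x, by simp [Block.elems],
      fun i => ⟨i, by simp [h3, hz], fun i' h => absurd rfl h⟩⟩

/-- A graded subspace of `V`, stable under `ad u`, on which the form `ω` is nondegenerate. -/
structure IsSplit {G : Type*} (A : G → Submodule ℂ L) (u : L) (l : ℕ) (V : Submodule ℂ L)
    (ω : L →ₗ[ℂ] L →ₗ[ℂ] ℂ) (W : Submodule ℂ L) : Prop where
  le : W ≤ V
  le_span : W ≤ Submodule.span ℂ {x | x ∈ W ∧ ∃ j, x ∈ component A u l j}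
  T_mem : ∀ x ∈ W, bracketHom u x ∈ W
  nondeg : ∀ x ∈ W, (∀ y ∈ W, ω x y = 0) → x = 0

/-- The block `B` consists of vectors from components of `W` and is stable under `ad u`. -/
def SplitsOff {G : Type*} (A : G → Submodule ℂ L) (u : L) {l : ℕ} (W : Submodule ℂ L)
    (B : Block L l) : Prop :=
  ∀ x ∈ B.elems, x ∈ W ∧ (∃ j, x ∈ component A u l j) ∧
    bracketHom u x ∈ Submodule.span ℂ B.elems

theorem scaledOrbit_mem_of_stable {u : L} {W : Submodule ℂ L} (hW : ∀ x ∈ W, bracketHom u x ∈ W)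
    {x : L} (hx : x ∈ W) (c : ℂ) (n : ℕ) : scaledOrbit (bracketHom u) c x n ∈ W := by
  refine Submodule.smul_mem _ _ ?_
  induction n with
  | zero => simpa using hx
  | succ n ih => rw [pow_succ', Module.End.mul_apply]; exact hW _ ih

theorem lie_scaledOrbit_succ (u : L) {c : ℂ} (hc : c ≠ 0) (x : L) {i j : ℕ} (hij : i + 1 = j) :
    ⁅u, scaledOrbit (bracketHom u) c x (i + 1)⁆ =
      c • scaledOrbit (bracketHom u) c x (j + 1) := by
  subst hij
  exact map_scaledOrbit _ hc x _

theorem lie_scaledOrbit_last {u : L} {l : ℕ} {c ε : ℂ} (hc : c ≠ 0) {x : L}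
    (hx : ((bracketHom u : Module.End ℂ L) ^ l) x = (ε * c ^ l) • x) {i j : ℕ}
    (hi : i + 1 = l) (hj : j = 0) :
    ⁅u, scaledOrbit (bracketHom u) c x (i + 1)⁆ =
      (c * ε) • scaledOrbit (bracketHom u) c x (j + 1) := by
  subst hj
  rw [lie_eq_bracketHom, map_scaledOrbit _ hc, hi, zero_add, add_comm l 1,
    scaledOrbit_add _ hc x hx, smul_smul]

theorem bracket_scaledOrbit_mem_span {u : L} {l : ℕ} {c ε : ℂ} (hc : c ≠ 0) {x : L}
    (hx : ((bracketHom u : Module.End ℂ L) ^ l) x = (ε * c ^ l) • x) {s : Set L}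
    (hs : ∀ i < l, scaledOrbit (bracketHom u) c x (i + 1) ∈ s) {i : ℕ} (hi : i < l) :
    bracketHom u (scaledOrbit (bracketHom u) c x (i + 1)) ∈ Submodule.span ℂ s := by
  by_cases h1 : i + 1 = l
  · rw [← lie_eq_bracketHom, lie_scaledOrbit_last hc hx h1 rfl]
    exact Submodule.smul_mem _ _ (Submodule.subset_span (hs 0 (by omega)))
  · rw [← lie_eq_bracketHom, lie_scaledOrbit_succ u hc x rfl]
    exact Submodule.smul_mem _ _ (Submodule.subset_span (hs _ (by omega)))

theorem bracket_pow_component {G : Type*} {A : G → Submodule ℂ L} {u : L} {l : ℕ} {g : G} {a : ZMod 2} {μ : ℂ} {x : L}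
    (hx : x ∈ component A u l (g, a, μ)) {m n : ℕ} (hn : n = m * l) :
    ((bracketHom u : Module.End ℂ L) ^ n) x = μ ^ m • x := by
  subst hn
  induction m with
  | zero => simp
  | succ m ih =>
    rw [add_mul, one_mul, pow_add, Module.End.mul_apply, (mem_component.1 hx).2.2, map_smul, ih,
      smul_smul, pow_succ']

namespace BlockSetting

variable {G : Type*} [AddCommGroup G] {A : G → Submodule ℂ L} {z u : L} {h gz : G}
    {l : ℕ} {Sc : Set ℂ} {V : Submodule ℂ L} {ω : L →ₗ[ℂ] L →ₗ[ℂ] ℂ}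
    (S : BlockSetting A z u h gz l Sc V ω)

include S

theorem scaledOrbit_component {j : G × ZMod 2 × ℂ} {x : L} (hx : x ∈ component A u l j) (c : ℂ)
    (n : ℕ) : ∃ j, scaledOrbit (bracketHom u) c x n ∈ component A u l j :=
  ⟨_, Submodule.smul_mem _ _ (S.component_T_pow hx n)⟩

theorem scaledOrbit_part {a : ZMod 2} {x : L} (hx : x ∈ (part a : Submodule ℂ L)) (c : ℂ)
    (n : ℕ) : scaledOrbit (bracketHom u) c x n ∈ (part a : Submodule ℂ L) :=
  scaledOrbit_mem_of_stable (fun _ => even_bracket_mem S.u_even) hx c n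

theorem T_pow_component_mem {j : G × ZMod 2 × ℂ} {x : L} (hx : x ∈ component A u l j) (n : ℕ) :
    ((bracketHom u : Module.End ℂ L) ^ n) x ∈ A (n • h + j.1) :=
  (S.component_T_pow hx n).1.1

/-- With c = -iα the block is x_i = c⁻ⁱTⁱx, y_i = c⁻ⁱTⁱy. The sign (-1)^l in the eigenvalue of y
produces both the sign in [u, y_l] and the exponent of -1 in [x_i, y_j]. -/
theorem exists_blockI_of_normalized {W : Submodule ℂ L} (hW : IsSplit A u l V ω W) {x y : L}
    (hx : x ∈ W) (hy : y ∈ W) {g g' : G} {a : ZMod 2} {α : ℂ} (hα : α ∈ Sc)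
    (hxc : x ∈ component A u l (g, a, (-Complex.I * α) ^ l))
    (hyc : y ∈ component A u l (g', a, (-1) ^ l * (-Complex.I * α) ^ l)) (hg : g + g' = gz)
    (hω : ω x y = if a = 0 then α else 1)
    (hxx : ∀ n, ω x (((bracketHom u : Module.End ℂ L) ^ n) x) = 0)
    (hyy : ∀ n, ω y (((bracketHom u : Module.End ℂ L) ^ n) y) = 0) :
    ∃ B : Block L l, B.IsBlock z u Sc ∧ SplitsOff A u W B := by
  have hα0 := S.scal_ne α hα
  have hc : -Complex.I * α ≠ 0 := mul_ne_zero (neg_ne_zero.2 Complex.I_ne_zero) hα0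
  have hxl := (mem_component.1 hxc).2.2
  have hyl := (mem_component.1 hyc).2.2
  have hxl' : ((bracketHom u : Module.End ℂ L) ^ l) x = (1 * (-Complex.I * α) ^ l) • x := by
    rw [one_mul, hxl]
  have hxV := hW.le hx
  have hyV := hW.le hy
  obtain ⟨b, hb⟩ : ∃ b : Fin l ⊕ Fin l → L, b = Sum.elim
      (fun i : Fin l => scaledOrbit (bracketHom u) (-Complex.I * α) x (i + 1))
      (fun i : Fin l => scaledOrbit (bracketHom u) (-Complex.I * α) y (i + 1)) := ⟨_, rfl⟩
  have hbx : ∀ i : Fin l, b (.inl i) =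
      scaledOrbit (bracketHom u) (-Complex.I * α) x (i + 1) := fun i => by rw [hb]; rfl
  have hby : ∀ i : Fin l, b (.inr i) =
      scaledOrbit (bracketHom u) (-Complex.I * α) y (i + 1) := fun i => by rw [hb]; rfl
  have hpart : ∀ i, b i ∈ (part a : Submodule ℂ L) := by
    rintro (i | i)
    · rw [hbx]; exact S.scaledOrbit_part (mem_component.1 hxc).2.1 _ _
    · rw [hby]; exact S.scaledOrbit_part (mem_component.1 hyc).2.1 _ _
  have u_x : ∀ i j : Fin l, (i : ℕ) + 1 = j →
      ⁅u, b (.inl i)⁆ = (-Complex.I * α) • b (.inl j) := by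
    intro i j hij
    rw [hbx, hbx]; exact lie_scaledOrbit_succ u hc x hij
  have u_y : ∀ i j : Fin l, (i : ℕ) + 1 = j →
      ⁅u, b (.inr i)⁆ = (-Complex.I * α) • b (.inr j) := by
    intro i j hij
    rw [hby, hby]; exact lie_scaledOrbit_succ u hc y hij
  have u_x_last : ∀ i j : Fin l, (i : ℕ) + 1 = l → (j : ℕ) = 0 →
      ⁅u, b (.inl i)⁆ = (-Complex.I * α) • b (.inl j) := by
    intro i j hi hj
    rw [hbx, hbx, lie_scaledOrbit_last hc hxl' hi hj, mul_one]
  have u_y_last : ∀ i j : Fin l, (i : ℕ) + 1 = l → (j : ℕ) = 0 →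
      ⁅u, b (.inr i)⁆ = (-(-1) ^ l * Complex.I * α) • b (.inr j) := by
    intro i j hi hj
    rw [hby, hby, lie_scaledOrbit_last hc hyl hi hj]
    congr 1
    ring
  have x_x : ∀ i j : Fin l, ⁅b (.inl i), b (.inl j)⁆ = 0 := by
    intro i j
    rw [hbx, hbx, S.lie_scaledOrbit hxV hxV, hxx, mul_zero, zero_smul]
  have y_y : ∀ i j : Fin l, ⁅b (.inr i), b (.inr j)⁆ = 0 := by
    intro i j
    rw [hby, hby, S.lie_scaledOrbit hyV hyV, hyy, mul_zero, zero_smul]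
  have x_y : ∀ i j : Fin l, ⁅b (.inl i), b (.inr j)⁆ =
      if ((i : ℕ) + 1) + (j + 1) = l ∨ ((i : ℕ) + 1) + (j + 1) = 2 * l
        then ((-1) ^ ((j : ℕ) + 1) * if a = 0 then α else 1) • z else 0 := by
    intro i j
    rw [hbx, hby, S.lie_scaledOrbit hxV hyV, ← hω]
    have hcl : (-Complex.I * α) ^ l ≠ 0 := pow_ne_zero _ hc
    have h1 : ((-1 : ℂ) ^ l) ^ 2 = 1 := by rw [← pow_mul, mul_comm, pow_mul]; simp
    split_ifs with hij
    · congr 1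
      rcases hij with hij | hij
      -- Moving Tⁱ across ω gives (-1)^i and T^l y gives (-1)^l; as i + j = l, the product is
      -- (-1)^j.
      · have h2 : ((-1 : ℂ) ^ ((i : ℕ) + 1)) * (-1) ^ l = (-1) ^ ((j : ℕ) + 1) := by
          generalize (i : ℕ) + 1 = p at hij ⊢
          generalize (j : ℕ) + 1 = q at hij ⊢
          rw [← hij, pow_add, ← mul_assoc, ← mul_pow]; simp
        rw [bracket_pow_component hyc (m := 1) (by omega), hij, map_smul, smul_eq_mul, inv_pow, ← h2]
        generalize (-Complex.I * α) ^ l = C at hcl ⊢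
        field_simp
      · have h2 : (i : ℕ) + 1 = l := by omega
        have h3 : (j : ℕ) + 1 = l := by omega
        rw [bracket_pow_component hyc (m := 2) hij, h2, h3, map_smul, smul_eq_mul, inv_pow, pow_add]
        generalize (-Complex.I * α) ^ l = C at hcl ⊢
        rw [mul_pow, h1]
        field_simp
    · rw [S.ω_T_pow_eq_zero hxV hyV (mem_component.1 hxc).1 (S.T_pow_component_mem hyc) (e := 0)
        (by simpa using hg), mul_zero, zero_smul]
      -- Both indices lie between 1 and l, so the only multiples of l their sum can equal are l and
      -- 2l.
      push Not at hij
      rintro ⟨d, hd⟩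
      have hi := i.2
      have hj := j.2
      have hd0 : 0 < d := by
        by_contra hd0
        have : (l : ℤ) * d ≤ 0 := mul_nonpos_of_nonneg_of_nonpos (by omega) (by omega)
        omega
      have hd3 : d < 3 := by
        by_contra hd3
        have : (l : ℤ) * 3 ≤ l * d := mul_le_mul_of_nonneg_left (by omega) (by omega)
        omega
      interval_cases d <;> omega
  have indep : LinearIndependent ℂ b :=
    (dualFamily_blockI S.z_ne (σ := fun j => (-1) ^ (j + 1) * if a = 0 then α else 1) hpart
      (fun n => mul_ne_zero (pow_ne_zero _ (by norm_num))
        (by split_ifs; exacts [hα0, one_ne_zero])) x_x y_y x_y).linearIndependent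
  have splits : ∀ v ∈ Set.range b, v ∈ W ∧ (∃ j, v ∈ component A u l j) ∧
      bracketHom u v ∈ Submodule.span ℂ (Set.range b) := by
    rintro _ ⟨i | i, rfl⟩
    · rw [hbx]
      exact ⟨scaledOrbit_mem_of_stable hW.T_mem hx _ _, S.scaledOrbit_component hxc _ _,
        bracket_scaledOrbit_mem_span hc hxl' (s := Set.range b)
          (fun i hi => ⟨Sum.inl ⟨i, hi⟩, hbx _⟩) i.2⟩
    · rw [hby]
      exact ⟨scaledOrbit_mem_of_stable hW.T_mem hy _ _, S.scaledOrbit_component hyc _ _,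
        bracket_scaledOrbit_mem_span hc hyl (s := Set.range b)
          (fun i hi => ⟨Sum.inr ⟨i, hi⟩, hby _⟩) i.2⟩
  obtain rfl | rfl : a = 0 ∨ a = 1 := (by decide : ∀ a : ZMod 2, a = 0 ∨ a = 1) a
  · exact ⟨.evenI (α, b), ⟨hα, S.z_even, S.u_even, hα0, hpart, indep, u_x, u_x_last, u_y, u_y_last,
      x_x, y_y, by simpa using x_y⟩, splits⟩
  · exact ⟨.oddI (α, b), ⟨hα, S.z_even, S.u_even, hα0, hpart, indep, u_x, u_x_last, u_y, u_y_last,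
      x_x, y_y, by simpa using x_y⟩, splits⟩

/-- Only y is rescaled, which brings ω(x, y) to the value required for the given parity and does not
disturb the isotropy of the orbit of y. -/
theorem exists_blockI {W : Submodule ℂ L} (hW : IsSplit A u l V ω W) {x y : L} (hx : x ∈ W)
    (hy : y ∈ W) {g g' : G} {a a' : ZMod 2} {μ μ' α : ℂ} (hα : α ∈ Sc)
    (hμ : μ = (-Complex.I * α) ^ l) (hxc : x ∈ component A u l (g, a, μ))
    (hyc : y ∈ component A u l (g', a', μ')) (hω : ω x y ≠ 0)
    (hxx : ∀ n, ω x (((bracketHom u : Module.End ℂ L) ^ n) x) = 0)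
    (hyy : ∀ n, ω y (((bracketHom u : Module.End ℂ L) ^ n) y) = 0) :
    ∃ B : Block L l, B.IsBlock z u Sc ∧ SplitsOff A u W B := by
  obtain ⟨hg, rfl, hμ'⟩ := S.ω_component (hW.le hx) (hW.le hy) hxc hyc hω
  have hμ'' : μ' = (-1) ^ l * (-Complex.I * α) ^ l := by
    rw [← hμ, hμ', ← mul_assoc, ← mul_pow]; simp
  subst hμ hμ''
  refine S.exists_blockI_of_normalized hW hx
    (Submodule.smul_mem _ ((ω x y)⁻¹ * if a' = 0 then α else 1) hy) hα hxc
    (Submodule.smul_mem _ _ hyc) hg ?_ hxx ?_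
  · rw [map_smul, smul_eq_mul]
    field_simp
  · intro n
    simp only [map_smul, LinearMap.smul_apply, hyy, smul_zero]

/-- Paired vectors have T^l-eigenvalues differing by the factor (-1)^l; equal nonzero eigenvalues
force this factor to be 1. -/
theorem even_order {x y : L} (hx : x ∈ V) (hy : y ∈ V) {g g' : G} {a a' : ZMod 2} {μ : ℂ}
    (hμ : μ ≠ 0) (hxc : x ∈ component A u l (g, a, μ)) (hyc : y ∈ component A u l (g', a', μ))
    (hω : ω x y ≠ 0) : Even l := by
  by_contra hl
  obtain ⟨-, -, h⟩ := S.ω_component hx hy hxc hyc hω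
  rw [(Nat.not_even_iff_odd.1 hl).neg_one_pow, neg_one_mul] at h
  exact hμ (self_eq_neg.1 h)

/-- The block is the single orbit c⁻ⁱTⁱx, i = 1, …, l, with c = -iα. Since ω(x, x) ≠ 0, twice the
degree of x is the degree of z, so only index sums divisible by l contribute. -/
theorem exists_oddII {W : Submodule ℂ L} (hW : IsSplit A u l V ω W) {x : L} (hx : x ∈ W)
    {g : G} {α : ℂ} (hα : α ∈ Sc) (hl : Even l)
    (hxc : x ∈ component A u l (g, 1, (-Complex.I * α) ^ l)) (hω : ω x x = 1) :
    ∃ B : Block L l, B.IsBlock z u Sc ∧ SplitsOff A u W B := by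
  have hα0 := S.scal_ne α hα
  have hc : -Complex.I * α ≠ 0 := mul_ne_zero (neg_ne_zero.2 Complex.I_ne_zero) hα0
  have hxl : ((bracketHom u : Module.End ℂ L) ^ l) x = (1 * (-Complex.I * α) ^ l) • x := by
    rw [one_mul, (mem_component.1 hxc).2.2]
  have hl2 : 2 * (l / 2) = l := Nat.two_mul_div_two_of_even hl
  have hxV := hW.le hx
  have hg : g + g = gz := (S.ω_component hxV hxV hxc hxc (by simp [hω])).1
  obtain ⟨b, hb⟩ : ∃ b : Fin (2 * (l / 2)) → L,
      ∀ i, b i = scaledOrbit (bracketHom u) (-Complex.I * α) x (i + 1) := ⟨_, fun i => rfl⟩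
  have hlie : ∀ i j : Fin (2 * (l / 2)), ⁅b i, b j⁆ =
      if ((i : ℕ) + 1) + (j + 1) = 2 * (l / 2) ∨ ((i : ℕ) + 1) + (j + 1) = 2 * (2 * (l / 2))
        then ((-1) ^ ((i : ℕ) + 1) : ℂ) • z else 0 := by
    intro i j
    have hi := i.2
    have hj := j.2
    rw [hb, hb, S.lie_scaledOrbit hxV hxV]
    have hcl : (-Complex.I * α) ^ l ≠ 0 := pow_ne_zero _ hc
    split_ifs with hij
    · congr 1
      replace hij : (i : ℕ) + 1 + (j + 1) = l ∨ (i : ℕ) + 1 + (j + 1) = 2 * l := by omega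
      rcases hij with hij | hij
      · rw [bracket_pow_component hxc (m := 1) (by omega), hij, map_smul, smul_eq_mul, inv_pow, hω]
        generalize (-Complex.I * α) ^ l = C at hcl ⊢
        field_simp
      · rw [bracket_pow_component hxc (m := 2) hij, hij, map_smul, smul_eq_mul, inv_pow,
          mul_comm 2 l, pow_mul, hω]
        generalize (-Complex.I * α) ^ l = C at hcl ⊢
        field_simp
    · rw [S.ω_T_pow_eq_zero hxV hxV (mem_component.1 hxc).1 (S.T_pow_component_mem hxc) (e := 0)
        (by simpa using hg), mul_zero, zero_smul]
      push Not at hij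
      rintro ⟨d, hd⟩
      have hd0 : 0 < d := by
        by_contra hd0
        have : (l : ℤ) * d ≤ 0 := mul_nonpos_of_nonneg_of_nonpos (by omega) (by omega)
        omega
      have hd3 : d < 3 := by
        by_contra hd3
        have : (l : ℤ) * 3 ≤ l * d := mul_le_mul_of_nonneg_left (by omega) (by omega)
        omega
      interval_cases d <;> omega
  refine ⟨.oddII (α, b), ⟨hl, hα, S.z_even, S.u_even, hα0, fun i => ?_,
    (dualFamily_blockII_odd S.z_ne (σ := fun i => (-1) ^ ((i : ℕ) + 1))
      (fun n => pow_ne_zero _ (by norm_num)) hlie).linearIndependent, ?_, ?_, hlie⟩, ?_⟩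
  · dsimp only
    rw [hb]
    exact S.scaledOrbit_part (mem_component.1 hxc).2.1 _ _
  · intro i j hij
    dsimp only
    rw [hb, hb]
    exact lie_scaledOrbit_succ u hc x hij
  · intro i j hi hj
    dsimp only
    rw [hb, hb, lie_scaledOrbit_last hc hxl (hi.trans hl2) hj, mul_one]
  · rintro _ ⟨i, rfl⟩
    dsimp only
    rw [hb]
    exact ⟨scaledOrbit_mem_of_stable hW.T_mem hx _ _, S.scaledOrbit_component hxc _ _,
      bracket_scaledOrbit_mem_span hc hxl (s := Set.range b) (fun i hi => ⟨⟨i, by omega⟩, hb _⟩) (by omega)⟩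

/-- Again a single orbit, but now ω(x, Tx) carries the pairing, so the index sum must be 1 modulo l,
that is l + 1. The normalization cα of ω(x, Tx), with c = -iα, cancels c^l / c^(l+1) and leaves the
value α up to sign. -/
theorem exists_evenII {W : Submodule ℂ L} (hW : IsSplit A u l V ω W) {x : L} (hx : x ∈ W)
    {g : G} {α : ℂ} (hα : α ∈ Sc) (hl : Even l)
    (hxc : x ∈ component A u l (g, 0, (-Complex.I * α) ^ l))
    (hω : ω x (bracketHom u x) = (-Complex.I * α) * α) :
    ∃ B : Block L l, B.IsBlock z u Sc ∧ SplitsOff A u W B := by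
  have hα0 := S.scal_ne α hα
  have hc : -Complex.I * α ≠ 0 := mul_ne_zero (neg_ne_zero.2 Complex.I_ne_zero) hα0
  have hxl : ((bracketHom u : Module.End ℂ L) ^ l) x = (1 * (-Complex.I * α) ^ l) • x := by
    rw [one_mul, (mem_component.1 hxc).2.2]
  have hl2 : 2 * (l / 2) = l := Nat.two_mul_div_two_of_even hl
  have hxV := hW.le hx
  have hg : g + (h + g) = gz :=
    (S.ω_component hxV (S.T_mem x hxV) hxc (S.component_T hxc)
      (by rw [hω]; exact mul_ne_zero hc hα0)).1
  obtain ⟨b, hb⟩ : ∃ b : Fin (2 * (l / 2)) → L,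
      ∀ i, b i = scaledOrbit (bracketHom u) (-Complex.I * α) x (i + 1) := ⟨_, fun i => rfl⟩
  have hlie : ∀ i j : Fin (2 * (l / 2)), ⁅b i, b j⁆ =
      if ((i : ℕ) + 1) + (j + 1) = 2 * (l / 2) + 1 then ((-1) ^ ((i : ℕ) + 1) * α) • z else 0 := by
    intro i j
    have hi := i.2
    have hj := j.2
    rw [hb, hb, S.lie_scaledOrbit hxV hxV]
    have hcl : (-Complex.I * α) ^ l ≠ 0 := pow_ne_zero _ hc
    split_ifs with hij
    · congr 1
      replace hij : (i : ℕ) + 1 + (j + 1) = l + 1 := by omega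
      rw [hij, pow_succ' (bracketHom u : Module.End ℂ L) l, Module.End.mul_apply, (mem_component.1 hxc).2.2, map_smul, map_smul,
        smul_eq_mul, pow_succ (-Complex.I * α)⁻¹ l, inv_pow, hω]
      generalize (-Complex.I * α) ^ l = C at hcl ⊢
      generalize -Complex.I * α = c at hc ⊢
      field_simp
    · rw [S.ω_T_pow_eq_zero hxV hxV (mem_component.1 hxc).1 (S.T_pow_component_mem hxc) (e := 1)
        (by simpa using hg), mul_zero, zero_smul]
      rintro ⟨d, hd⟩
      have hd0 : 0 < d := by
        by_contra hd0
        have : (l : ℤ) * d ≤ 0 := mul_nonpos_of_nonneg_of_nonpos (by omega) (by omega)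
        omega
      have hd2 : d < 2 := by
        by_contra hd2
        have : (l : ℤ) * 2 ≤ l * d := mul_le_mul_of_nonneg_left (by omega) (by omega)
        omega
      interval_cases d
      omega
  refine ⟨.evenII (α, b), ⟨hl, hα, S.z_even, S.u_even, hα0, fun i => ?_,
    (dualFamily_blockII_even S.z_ne (σ := fun i => (-1) ^ ((i : ℕ) + 1) * α)
      (fun n => mul_ne_zero (pow_ne_zero _ (by norm_num)) hα0) hlie).linearIndependent,
      ?_, ?_, hlie⟩, ?_⟩
  · dsimp only
    rw [hb]
    exact S.scaledOrbit_part (mem_component.1 hxc).2.1 _ _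
  · intro i j hij
    dsimp only
    rw [hb, hb]
    exact lie_scaledOrbit_succ u hc x hij
  · intro i j hi hj
    dsimp only
    rw [hb, hb, lie_scaledOrbit_last hc hxl (hi.trans hl2) hj, mul_one]
  · rintro _ ⟨i, rfl⟩
    dsimp only
    rw [hb]
    exact ⟨scaledOrbit_mem_of_stable hW.T_mem hx _ _, S.scaledOrbit_component hxc _ _,
      bracket_scaledOrbit_mem_span hc hxl (s := Set.range b) (fun i hi => ⟨⟨i, by omega⟩, hb _⟩) (by omega)⟩

/-- A vector not orthogonal to its own orbit is moved to the middle: with y = T^k x, k = ⌊n/2⌋, the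
nonzero value becomes ω(y, y) or ω(y, Ty) up to sign. A square root then normalizes it. -/
theorem exists_blockII {W : Submodule ℂ L} (hW : IsSplit A u l V ω W) {x : L} (hx : x ∈ W)
    {g : G} {a : ZMod 2} {α : ℂ} (hα : α ∈ Sc)
    (hxc : x ∈ component A u l (g, a, (-Complex.I * α) ^ l)) {n : ℕ}
    (hn : ω x (((bracketHom u : Module.End ℂ L) ^ n) x) ≠ 0) :
    ∃ B : Block L l, B.IsBlock z u Sc ∧ SplitsOff A u W B := by
  have hα0 := S.scal_ne α hα
  have hc : -Complex.I * α ≠ 0 := mul_ne_zero (neg_ne_zero.2 Complex.I_ne_zero) hα0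
  have hxV := hW.le hx
  have hl : Even l := S.even_order hxV (S.T_pow_mem hxV n) (pow_ne_zero l hc) hxc
    (S.component_T_pow hxc n) hn
  have hW_pow : ∀ k, ((bracketHom u : Module.End ℂ L) ^ k) x ∈ W := by
    intro k
    simpa [scaledOrbit] using scaledOrbit_mem_of_stable hW.T_mem hx 1 k
  have hsq : ∀ κ : ℂ, ∃ w, w * w = κ := fun κ => by
    obtain ⟨w, hw⟩ := IsAlgClosed.exists_pow_nat_eq κ (n := 2) (by norm_num)
    exact ⟨w, by rw [← sq, hw]⟩
  have ha : a = 0 ∨ a = 1 := (by decide : ∀ a : ZMod 2, a = 0 ∨ a = 1) a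
  obtain ⟨k, rfl | rfl⟩ := n.even_or_odd'
  · obtain ⟨y, hy⟩ : ∃ y, y = ((bracketHom u : Module.End ℂ L) ^ k) x := ⟨_, rfl⟩
    have hyW : y ∈ W := hy ▸ hW_pow k
    have hyc := S.component_T_pow hxc k
    rw [← hy] at hyc
    have hyy : ω y y ≠ 0 := by
      rw [hy, S.ω_T_pow hxV (S.T_pow_mem hxV k), ← Module.End.mul_apply, ← pow_add, ← two_mul]
      exact mul_ne_zero (pow_ne_zero _ (by norm_num)) hn
    have hs := S.ω_skew (hW.le hyW) (hW.le hyW) (mem_component.1 hyc).2.1 (mem_component.1 hyc).2.1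
    rcases ha with rfl | rfl
    · simp only [parSign, zero_ne_one, and_self, if_false, one_mul] at hs
      -- On even vectors ω is alternating, so ω(y, y) ≠ 0 excludes even parity.
      exact absurd (self_eq_neg.1 hs) hyy
    · obtain ⟨w, hw⟩ := hsq (ω y y)⁻¹
      refine S.exists_oddII hW (Submodule.smul_mem _ w hyW) hα hl (Submodule.smul_mem _ w hyc) ?_
      rw [map_smul, map_smul, LinearMap.smul_apply, smul_eq_mul, smul_eq_mul, ← mul_assoc, hw,
        inv_mul_cancel₀ hyy]
  · obtain ⟨y, hy⟩ : ∃ y, y = ((bracketHom u : Module.End ℂ L) ^ k) x := ⟨_, rfl⟩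
    have hyW : y ∈ W := hy ▸ hW_pow k
    have hyc := S.component_T_pow hxc k
    rw [← hy] at hyc
    have hyy : ω y (bracketHom u y) ≠ 0 := by
      rw [hy, S.ω_T_pow hxV (S.T_mem _ (S.T_pow_mem hxV k)), ← Module.End.mul_apply,
        ← Module.End.mul_apply, ← pow_succ, ← pow_add,
        show k + 1 + k = 2 * k + 1 by ring]
      exact mul_ne_zero (pow_ne_zero _ (by norm_num)) hn
    have hyV := hW.le hyW
    have hs := S.ω_skew (S.T_mem y hyV) hyV
      (even_bracket_mem S.u_even (mem_component.1 hyc).2.1) (mem_component.1 hyc).2.1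
    rw [S.ω_T hyV hyV] at hs
    rcases ha with rfl | rfl
    · obtain ⟨w, hw⟩ := hsq ((-Complex.I * α * α) * (ω y (bracketHom u y))⁻¹)
      refine S.exists_evenII hW (Submodule.smul_mem _ w hyW) hα hl (Submodule.smul_mem _ w hyc) ?_
      rw [map_smul, map_smul, map_smul, LinearMap.smul_apply, smul_eq_mul, smul_eq_mul,
        ← mul_assoc, hw, inv_mul_cancel_right₀ hyy]
    -- On odd vectors ω is symmetric while T is skew for ω; hence ω(y, Ty) = 0, which excludes odd
    -- parity.
    · simp only [parSign, and_self, if_true, neg_one_mul, neg_neg] at hs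
      exact absurd (neg_eq_self.1 hs) hyy

end BlockSetting
end LieSuperalgebra

/-! ### Splitting off blocks by orthogonal complements -/

namespace LieSuperalgebra

variable {L : Type*} [AddCommGroup L] [Module ℂ L] [LieSuperalgebra L]

theorem Block.IsBlock.elems_nonempty {z u : L} {l : ℕ} {Sc : Set ℂ} {B : Block L l}
    (hB : B.IsBlock z u Sc) (hl : 0 < l) : B.elems.Nonempty := by
  rcases B with d | d | d | d | d | x
  · exact ⟨_, Sum.inl ⟨0, hl⟩, rfl⟩
  · exact ⟨_, Sum.inl ⟨0, hl⟩, rfl⟩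
  · obtain ⟨k, hk⟩ := hB.1
    exact ⟨_, ⟨0, by omega⟩, rfl⟩
  · obtain ⟨k, hk⟩ := hB.1
    exact ⟨_, ⟨0, by omega⟩, rfl⟩
  · exact ⟨d.1, Or.inl rfl⟩
  · exact ⟨x, rfl⟩

theorem exists_ne_zero_of_nondegenerate {M : Type*} [AddCommGroup M] [Module ℂ M]
    {ω : M →ₗ[ℂ] M →ₗ[ℂ] ℂ} {W : Submodule ℂ M} (hW0 : W ≠ ⊥)
    (hW : ∀ x ∈ W, (∀ y ∈ W, ω x y = 0) → x = 0) {s : Set M} (hsW : s ⊆ W)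
    (hs : W ≤ Submodule.span ℂ s) : ∃ x ∈ s, ∃ y ∈ s, ω x y ≠ 0 := by
  by_contra! hcon
  apply hW0
  rw [eq_bot_iff]
  refine hs.trans (Submodule.span_le.2 fun x hx => hW x (hsW hx) fun y hy => ?_)
  have : Submodule.span ℂ s ≤ LinearMap.ker (ω x) := Submodule.span_le.2 (hcon x hx)
  exact this (hs hy)

theorem IsSplit.exists_pairing {G : Type*} {A : G → Submodule ℂ L} {u : L} {l : ℕ}
    {V : Submodule ℂ L} {ω : L →ₗ[ℂ] L →ₗ[ℂ] ℂ} {W : Submodule ℂ L} (hW : IsSplit A u l V ω W)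
    (hW0 : W ≠ ⊥) : ∃ x ∈ W, ∃ y ∈ W, ∃ i j, x ∈ component A u l i ∧ y ∈ component A u l j ∧
      ω x y ≠ 0 := by
  obtain ⟨x, ⟨hx, i, hi⟩, y, ⟨hy, j, hj⟩, hω⟩ :=
    exists_ne_zero_of_nondegenerate hW0 hW.nondeg (fun _ h => h.1) hW.le_span
  exact ⟨x, hx, y, hy, i, j, hi, hj, hω⟩

namespace BlockSetting

variable {G : Type*} [AddCommGroup G] {A : G → Submodule ℂ L} {z u : L} {h gz : G}
    {l : ℕ} {Sc : Set ℂ} {V : Submodule ℂ L} {ω : L →ₗ[ℂ] L →ₗ[ℂ] ℂ}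
    (S : BlockSetting A z u h gz l Sc V ω)

include S

theorem exists_single {W : Submodule ℂ L} (hW : IsSplit A u l V ω W) {x : L} (hx : x ∈ W)
    {g : G} {μ : ℂ} (hxc : x ∈ component A u l (g, 1, μ)) (hux : bracketHom u x = 0)
    (hω : ω x x ≠ 0) : ∃ B : Block L l, B.IsBlock z u Sc ∧ SplitsOff A u W B := by
  obtain ⟨w, hw⟩ := IsAlgClosed.exists_pow_nat_eq (ω x x)⁻¹ (n := 2) (by norm_num)
  have huw : bracketHom u (w • x) = 0 := by rw [map_smul, hux, smul_zero]
  have hwW : w • x ∈ W := Submodule.smul_mem _ w hx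
  have hwc : w • x ∈ component A u l (g, 1, μ) := Submodule.smul_mem _ w hxc
  refine ⟨.single (w • x), ⟨(mem_component.1 hwc).2.1, huw, ?_⟩, ?_⟩
  · rw [lie_eq_bracketHom, S.lie_eq _ (hW.le hwW) _ (hW.le hwW), map_smul, map_smul,
      LinearMap.smul_apply, smul_eq_mul, smul_eq_mul, ← mul_assoc, ← sq, hw, inv_mul_cancel₀ hω,
      one_smul]
  · rintro _ rfl
    exact ⟨hwW, ⟨_, hwc⟩, by rw [huw]; exact Submodule.zero_mem _⟩

theorem exists_pair {W : Submodule ℂ L} (hW : IsSplit A u l V ω W) {x y : L} (hx : x ∈ W)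
    (hy : y ∈ W) {g g' : G} {μ μ' : ℂ} (hxc : x ∈ component A u l (g, 1, μ))
    (hyc : y ∈ component A u l (g', 1, μ')) (hux : bracketHom u x = 0) (huy : bracketHom u y = 0)
    (hω : ω x y ≠ 0) (hxx : ω x x = 0) (hyy : ω y y = 0) :
    ∃ B : Block L l, B.IsBlock z u Sc ∧ SplitsOff A u W B := by
  obtain ⟨w, hw⟩ : ∃ w, w = (ω x y)⁻¹ := ⟨_, rfl⟩
  have huw : bracketHom u (w • y) = 0 := by rw [map_smul, huy, smul_zero]
  have hwW : w • y ∈ W := Submodule.smul_mem _ w hy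
  have hwc : w • y ∈ component A u l (g', 1, μ') := Submodule.smul_mem _ w hyc
  refine ⟨.pair (x, w • y), ⟨(mem_component.1 hxc).2.1, (mem_component.1 hwc).2.1, hux, huw,
    ?_, ?_, ?_⟩, ?_⟩
  · rw [lie_eq_bracketHom, S.lie_eq _ (hW.le hx) _ (hW.le hwW), map_smul, smul_eq_mul, hw,
      inv_mul_cancel₀ hω, one_smul]
  · rw [lie_eq_bracketHom, S.lie_eq _ (hW.le hx) _ (hW.le hx), hxx, zero_smul]
  · rw [lie_eq_bracketHom, S.lie_eq _ (hW.le hwW) _ (hW.le hwW)]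
    simp [hyy]
  · rintro _ (rfl | rfl)
    · exact ⟨hx, ⟨_, hxc⟩, by rw [hux]; exact Submodule.zero_mem _⟩
    · exact ⟨hwW, ⟨_, hwc⟩, by rw [huw]; exact Submodule.zero_mem _⟩

/-- Every nonzero split subspace contains a block. -/
theorem exists_block {W : Submodule ℂ L} (hW : IsSplit A u l V ω W) (hW0 : W ≠ ⊥) :
    ∃ B : Block L l, B.IsBlock z u Sc ∧ SplitsOff A u W B := by
  obtain ⟨x, hx, y, hy, ⟨g, a, μ⟩, ⟨g', a', μ'⟩, hxc, hyc, hω⟩ := hW.exists_pairing hW0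
  have hxV := hW.le hx
  have hyV := hW.le hy
  obtain ⟨hg, rfl, hμ⟩ := S.ω_component hxV hyV hxc hyc hω
  have hx0 : x ≠ 0 := by rintro rfl; simp at hω
  have hy0 : y ≠ 0 := by rintro rfl; simp at hω
  have hpow0 : ∀ v : L, bracketHom u v = 0 →
      ((bracketHom u : Module.End ℂ L) ^ l) v = 0 := by
    intro v hv
    obtain ⟨n, rfl⟩ := Nat.exists_eq_succ_of_ne_zero S.l_pos.ne'
    rw [Nat.succ_eq_add_one, pow_succ, Module.End.mul_apply, hv, map_zero]
  have hne : ∀ α ∈ Sc, (-Complex.I * α) ^ l ≠ 0 := fun α hα =>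
    pow_ne_zero _ (mul_ne_zero (neg_ne_zero.2 Complex.I_ne_zero) (S.scal_ne α hα))
  have hzero : ∀ {v : L} {ν : ℂ}, v ≠ 0 → bracketHom u v = 0 →
      ((bracketHom u : Module.End ℂ L) ^ l) v = ν • v → ν = 0 := by
    intro v ν hv huv hν
    rw [hpow0 v huv] at hν
    exact (smul_eq_zero.1 hν.symm).resolve_right hv
  rcases S.T_pow x hxV hx0 μ (mem_component.1 hxc).2.2 with hux | ⟨α, hα, hαμ⟩
  · have hμ0 : μ' = 0 := by
      have := hzero hx0 hux (mem_component.1 hxc).2.2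
      rw [this] at hμ
      exact (mul_eq_zero.1 hμ.symm).resolve_left (pow_ne_zero _ (by norm_num))
    have huy : bracketHom u y = 0 := by
      rcases S.T_pow y hyV hy0 μ' (mem_component.1 hyc).2.2 with huy | ⟨α, hα, hαμ⟩
      · exact huy
      · exact absurd (hαμ.symm.trans hμ0) (hne α hα)
    -- T is injective on the even part of V, so vectors killed by T are odd here. ω is then
    -- symmetric, and a non-isotropic one of x, y gives a single element, while two isotropic ones
    -- give a pair.
    obtain rfl | rfl := (by decide : ∀ a : ZMod 2, a = 0 ∨ a = 1) a'
    · exact absurd (S.T_ker x hxV (mem_component.1 hxc).2.1 hux) hx0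
    · by_cases hxx : ω x x = 0
      · by_cases hyy : ω y y = 0
        · exact S.exists_pair hW hx hy hxc hyc hux huy hω hxx hyy
        · exact S.exists_single hW hy hyc huy hyy
      · exact S.exists_single hW hx hxc hux hxx
  · have hμ0 : μ ≠ 0 := hαμ ▸ hne α hα
    -- Needed because a block of type II may have to be built from y, whose T^l-eigenvalue (-1)^l μ
    -- comes with its own scalar.
    obtain ⟨β, hβ, hβμ⟩ : ∃ β ∈ Sc, μ' = (-Complex.I * β) ^ l := by
      refine (S.T_pow y hyV hy0 μ' (mem_component.1 hyc).2.2).resolve_left fun huy => hμ0 ?_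
      rw [hμ, hzero hy0 huy (mem_component.1 hyc).2.2, mul_zero]
    by_cases hxx : ∀ n, ω x (((bracketHom u : Module.End ℂ L) ^ n) x) = 0
    · by_cases hyy : ∀ n, ω y (((bracketHom u : Module.End ℂ L) ^ n) y) = 0
      · exact S.exists_blockI hW hx hy hα hαμ hxc hyc hω hxx hyy
      · push Not at hyy
        obtain ⟨n, hn⟩ := hyy
        exact S.exists_blockII hW hy hβ (hβμ ▸ hyc) hn
    · push Not at hxx
      obtain ⟨n, hn⟩ := hxx
      exact S.exists_blockII hW hx hα (hαμ ▸ hxc) hn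

/-- The orthogonal complement of a block in a split subspace is again split. -/
theorem exists_complement {W : Submodule ℂ L} (hW : IsSplit A u l V ω W) {B : Block L l}
    (hB : B.IsBlock z u Sc) (hWB : SplitsOff A u W B) :
    ∃ W' : Submodule ℂ L, IsSplit A u l V ω W' ∧ W' < W ∧
      Submodule.span ℂ B.elems ⊔ W' = W ∧ ∀ x ∈ W', ∀ y ∈ B.elems, ω x y = 0 := by
  classical
  obtain ⟨ι, _, b, hb, hdual⟩ := hB.exists_dualFamily S.z_ne
  have hbW : ∀ i, b i ∈ W := fun i => (hWB (b i) (hb ▸ ⟨i, rfl⟩)).1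
  have hbV : ∀ i, b i ∈ V := fun i => hW.le (hbW i)
  have hbc : ∀ i, ∃ j, b i ∈ component A u l j := fun i => (hWB (b i) (hb ▸ ⟨i, rfl⟩)).2.1
  have hlie : ∀ i j, ⁅b i, b j⁆ = 0 ↔ ω (b i) (b j) = 0 := by
    intro i j
    rw [lie_eq_bracketHom, S.lie_eq _ (hbV i) _ (hbV j), smul_eq_zero]
    simp [S.z_ne]
  choose τ hτ hτ' using hdual
  simp only [ne_eq, hlie] at hτ hτ'
  obtain ⟨W', hW'⟩ : ∃ W' : Submodule ℂ L, ∀ x, x ∈ W' ↔ x ∈ W ∧ ∀ i, ω x (b i) = 0 :=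
    ⟨W ⊓ ⨅ i, LinearMap.ker (ω.flip (b i)), fun x => by simp [Submodule.mem_iInf]⟩
  -- The projection along the span of the block: the coefficient of `b i` is read off by pairing
  -- with its partner `b (τ i)`.
  obtain ⟨P, hP⟩ : ∃ P : L →ₗ[ℂ] L, ∀ x, P x =
      x - ∑ i, ((ω (b i) (b (τ i)))⁻¹ * ω x (b (τ i))) • b i :=
    ⟨LinearMap.id - ∑ i, ((ω (b i) (b (τ i)))⁻¹ • ω.flip (b (τ i))).smulRight (b i), fun x => by
      simp [LinearMap.sum_apply]⟩
  -- Orthogonality to the partners amounts to orthogonality to the block: partners are distinct, and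
  -- the block is finite.
  have hτsurj : Function.Surjective τ := by
    refine Finite.surjective_of_injective fun i j hij => ?_
    by_contra hne
    have := hτ' j i hne
    rw [← hij] at this
    exact hτ i this
  have hPW : ∀ x ∈ W, P x ∈ W := fun x hx => by
    rw [hP]
    exact Submodule.sub_mem _ hx (Submodule.sum_mem _ fun i _ => Submodule.smul_mem _ _ (hbW i))
  have hPW' : ∀ x ∈ W, P x ∈ W' := fun x hx => by
    rw [hW']
    refine ⟨hPW x hx, fun j => ?_⟩
    obtain ⟨i, rfl⟩ := hτsurj j
    rw [hP, map_sub, map_sum, LinearMap.sub_apply, LinearMap.sum_apply,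
      Finset.sum_eq_single i]
    · rw [map_smul, LinearMap.smul_apply, smul_eq_mul, mul_comm, mul_inv_cancel_left₀ (hτ i),
        sub_self]
    · intro i' _ hi'
      rw [map_smul, LinearMap.smul_apply, hτ' i i' hi', smul_zero]
    · exact fun h => absurd (Finset.mem_univ _) h
  have hPid : ∀ x ∈ W', P x = x := fun x hx => by
    rw [hP, Finset.sum_eq_zero, sub_zero]
    intro i _
    rw [((hW' x).1 hx).2, mul_zero, zero_smul]
  have hPspan : ∀ x, x - P x ∈ Submodule.span ℂ B.elems := fun x => by
    rw [hP, sub_sub_cancel, ← hb]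
    exact Submodule.sum_mem _ fun i _ => Submodule.smul_mem _ _ (Submodule.subset_span ⟨i, rfl⟩)
  -- If the term of `b i` is nonzero, then x and `b i` both pair with `b (τ i)`, hence lie in the
  -- same component.
  have hPc : ∀ x ∈ W, ∀ j, x ∈ component A u l j → P x ∈ component A u l j := by
    intro x hx j hj
    rw [hP]
    refine Submodule.sub_mem _ hj (Submodule.sum_mem _ fun i _ => ?_)
    by_cases hω : ω x (b (τ i)) = 0
    · rw [hω, mul_zero, zero_smul]
      exact Submodule.zero_mem _
    · obtain ⟨k, hk⟩ := hbc i
      obtain ⟨k', hk'⟩ := hbc (τ i)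
      rw [S.component_eq (hW.le hx) (hbV i) (hbV (τ i)) hj hk hk' hω (hτ i)]
      exact Submodule.smul_mem _ _ hk
  have hW'W : W' ≤ W := fun x hx => ((hW' x).1 hx).1
  have hspanW : Submodule.span ℂ B.elems ≤ W :=
    Submodule.span_le.2 fun x hx => (hWB x hx).1
  have horth : ∀ x ∈ W', ∀ y ∈ Submodule.span ℂ B.elems, ω x y = 0 := by
    intro x hx y hy
    have : Submodule.span ℂ B.elems ≤ LinearMap.ker (ω x) := by
      rw [← hb, Submodule.span_le]
      rintro _ ⟨i, rfl⟩
      exact ((hW' x).1 hx).2 i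
    exact this hy
  have hsup : Submodule.span ℂ B.elems ⊔ W' = W := by
    refine le_antisymm (sup_le hspanW hW'W) fun x hx => ?_
    rw [← sub_add_cancel x (P x)]
    exact Submodule.add_mem_sup (hPspan x) (hPW' x hx)
  refine ⟨W', ⟨hW'W.trans hW.le, fun x hx => ?_, fun x hx => ?_, fun x hx hxy => ?_⟩, ?_, hsup,
    fun x hx y hy => horth x hx y (Submodule.subset_span hy)⟩
  · rw [← hPid x hx]
    have : Submodule.span ℂ {x | x ∈ W ∧ ∃ j, x ∈ component A u l j} ≤
        (Submodule.span ℂ {x | x ∈ W' ∧ ∃ j, x ∈ component A u l j}).comap P := by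
      rw [Submodule.span_le]
      rintro y ⟨hy, j, hj⟩
      exact Submodule.subset_span ⟨hPW' y hy, j, hPc y hy j hj⟩
    exact this (hW.le_span (hW'W hx))
  · rw [hW']
    refine ⟨hW.T_mem x (hW'W hx), fun i => ?_⟩
    rw [S.ω_T (hW.le (hW'W hx)) (hbV i), horth x hx _ (hWB (b i) (hb ▸ ⟨i, rfl⟩)).2.2, neg_zero]
  · refine hW.nondeg x (hW'W hx) fun y hy => ?_
    rw [← sub_add_cancel y (P y), map_add, horth x hx _ (hPspan y), hxy _ (hPW' y hy), add_zero]
  · refine lt_of_le_of_ne hW'W fun heq => ?_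
    have hne : Nonempty ι := by
      obtain ⟨x, hx⟩ := hB.elems_nonempty S.l_pos
      rw [← hb] at hx
      exact ⟨hx.choose⟩
    obtain ⟨i⟩ := hne
    exact hτ i (((hW' (b i)).1 (heq ▸ hbW i)).2 (τ i))

/-- Well-founded induction on `W`. Each block is orthogonal to the complement from which the later
blocks are taken, so orthogonality is recorded in one order only. -/
theorem exists_blocks [FiniteDimensional ℂ L] (W : Submodule ℂ L) (hW : IsSplit A u l V ω W) :
    ∃ Bs : List (Block L l), (∀ B ∈ Bs, B.IsBlock z u Sc ∧ SplitsOff A u W B) ∧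
      Bs.Pairwise (fun B B' => ∀ x ∈ B.elems, ∀ y ∈ B'.elems, ω y x = 0) ∧
      W ≤ Submodule.span ℂ {x | ∃ B ∈ Bs, x ∈ B.elems} := by
  induction W using WellFoundedLT.induction with
  | ind W ih =>
    by_cases hW0 : W = ⊥
    · exact ⟨[], by simp, by simp, by simp [hW0]⟩
    · obtain ⟨B, hB, hWB⟩ := S.exists_block hW hW0
      obtain ⟨W', hW', hlt, hsup, horth⟩ := S.exists_complement hW hB hWB
      obtain ⟨Bs, h1, h2, h3⟩ := ih W' hlt hW'
      refine ⟨B :: Bs, ?_, List.pairwise_cons.2 ⟨fun B' hB' x hx y hy =>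
        horth y ((h1 B' hB').2 y hy).1 x hx, h2⟩, ?_⟩
      · intro B' hB'
        rcases List.mem_cons.1 hB' with rfl | hB'
        · exact ⟨hB, hWB⟩
        · exact ⟨(h1 B' hB').1, fun x hx =>
            ⟨hlt.le ((h1 B' hB').2 x hx).1, ((h1 B' hB').2 x hx).2⟩⟩
      · rw [← hsup]
        refine sup_le (Submodule.span_mono fun x hx => ⟨B, by simp, hx⟩)
          (h3.trans (Submodule.span_mono ?_))
        rintro x ⟨B', hB', hx⟩
        exact ⟨B', by simp [hB'], hx⟩

end BlockSetting
end LieSuperalgebra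

/-! ### Diagonalizable operators and their powers -/

namespace Module.End

variable {M : Type*} [AddCommGroup M] [Module ℂ M] {T : Module.End ℂ M}

/-- The range lies in the sum of the eigenspaces for nonzero eigenvalues, which is independent of
the kernel. -/
theorem disjoint_ker_range_of_iSup_eigenspace (hT : ⨆ ν, T.eigenspace ν = ⊤) :
    Disjoint (LinearMap.ker T) (LinearMap.range T) := by
  have h := T.eigenspaces_iSupIndep 0
  rw [Module.End.eigenspace_zero] at h
  refine h.mono_right ?_
  rintro _ ⟨x, rfl⟩
  have hx : x ∈ ⨆ ν, T.eigenspace ν := hT ▸ Submodule.mem_top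
  induction hx using Submodule.iSup_induction' with
  | mem ν x hx =>
    rw [Module.End.mem_eigenspace_iff.1 hx]
    by_cases hν : ν = 0
    · rw [hν, zero_smul]; exact Submodule.zero_mem _
    · exact Submodule.smul_mem _ _ (Submodule.mem_iSup_of_mem ν (Submodule.mem_iSup_of_mem hν hx))
  | zero => rw [map_zero]; exact Submodule.zero_mem _
  | add x y _ _ hx hy => rw [map_add]; exact Submodule.add_mem _ hx hy

theorem apply_eq_zero_of_pow_apply_eq_zero (hT : ⨆ ν, T.eigenspace ν = ⊤) {n : ℕ} {x : M}
    (hx : (T ^ n) x = 0) : T x = 0 := by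
  induction n generalizing x with
  | zero =>
    have : x = 0 := by simpa using hx
    rw [this, map_zero]
  | succ n ih =>
    rw [pow_succ, Module.End.mul_apply] at hx
    exact Submodule.disjoint_def.1 (disjoint_ker_range_of_iSup_eigenspace hT) _
      (LinearMap.mem_ker.2 (ih hx)) ⟨x, rfl⟩

theorem eigenspace_le_eigenspace_pow (T : Module.End ℂ M) (ν : ℂ) (l : ℕ) :
    T.eigenspace ν ≤ (T ^ l).eigenspace (ν ^ l) := by
  intro x hx
  rw [Module.End.mem_eigenspace_iff] at hx ⊢
  induction l with
  | zero => simp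
  | succ l ih => rw [pow_succ, Module.End.mul_apply, hx, map_smul, ih, smul_smul, pow_succ']

/-- The eigenspaces of T already fill the space and lie in the eigenspaces of T^l for the values
ν^l; an eigenvector for any other value would contradict independence of eigenspaces. -/
theorem exists_eq_pow_of_pow_apply {E : Set ℂ} (hT : ⨆ ν ∈ E, T.eigenspace ν = ⊤) {l : ℕ}
    {x : M} (hx : x ≠ 0) {μ : ℂ} (hμ : (T ^ l) x = μ • x) : ∃ ν ∈ E, μ = ν ^ l := by
  by_contra! hcon
  apply hx
  refine Submodule.disjoint_def.1 ((T ^ l).eigenspaces_iSupIndep μ) x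
    (Module.End.mem_eigenspace_iff.2 hμ) ?_
  have : (⊤ : Submodule ℂ M) ≤ ⨆ j, ⨆ (_ : j ≠ μ), (T ^ l).eigenspace j := by
    rw [← hT]
    exact iSup₂_le fun ν hν => (eigenspace_le_eigenspace_pow T ν l).trans
      (le_iSup₂_of_le (ν ^ l) (hcon ν hν).symm le_rfl)
  exact this Submodule.mem_top

theorem iSup_eigenspace_pow (hT : ⨆ ν, T.eigenspace ν = ⊤) (l : ℕ) :
    ⨆ ν, (T ^ l).eigenspace ν = ⊤ := by
  rw [eq_top_iff, ← hT]
  exact iSup_le fun ν => (eigenspace_le_eigenspace_pow T ν l).trans (le_iSup _ _)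

end Module.End

/-! ### Parity and degree in a graded superalgebra -/

namespace LieSuperalgebra

variable {L : Type*} [AddCommGroup L] [Module ℂ L] [LieSuperalgebra L]

/-- The spans of the homogeneous even and of the homogeneous odd vectors lie in complementary
subspaces and together fill L, so each equals the part containing it. -/
theorem IsGroupGrading.part_le_span {G : Type*} [AddCommGroup G] [DecidableEq G]
    {A : G → Submodule ℂ L} (hA : IsGroupGrading A) (a : ZMod 2) :
    (part a : Submodule ℂ L) ≤ Submodule.span ℂ {x | x ∈ (part a : Submodule ℂ L) ∧
      ∃ g, x ∈ A g} := by
  obtain ⟨N, hN⟩ : ∃ N : ZMod 2 → Submodule ℂ L,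
      ∀ a, N a = Submodule.span ℂ {x | x ∈ (part a : Submodule ℂ L) ∧ ∃ g, x ∈ A g} :=
    ⟨_, fun _ => rfl⟩
  have hle : ∀ a, N a ≤ part a := fun a => by
    rw [hN]; exact Submodule.span_le.2 fun x hx => hx.1
  have hmem : ∀ a g, A g ⊓ part a ≤ N a := fun a g x hx => by
    rw [hN]; exact Submodule.subset_span ⟨hx.2, g, hx.1⟩
  have htop : ⊤ ≤ N 0 ⊔ N 1 := by
    rw [← hA.isInternal.submodule_iSup_eq_top]
    refine iSup_le fun g => ?_
    rw [hA.parity g]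
    exact sup_le_sup (hmem 0 g) (hmem 1 g)
  rw [← hN]
  intro x hx
  obtain ⟨y0, h0, y1, h1, rfl⟩ := Submodule.mem_sup.1 (htop (Submodule.mem_top (x := x)))
  obtain rfl | rfl := (by decide : ∀ a : ZMod 2, a = 0 ∨ a = 1) a
  · have : y1 = 0 := eq_zero_of_mem_even_of_mem_odd
      (by simpa using Submodule.sub_mem _ hx (hle 0 h0)) (hle 1 h1)
    rwa [this, add_zero]
  · have : y0 = 0 := eq_zero_of_mem_even_of_mem_odd (hle 0 h0)
      (by simpa using Submodule.sub_mem _ hx (hle 1 h1))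
    rwa [this, zero_add]

theorem IsGroupGrading.eq_of_mem {G : Type*} [AddCommGroup G] [DecidableEq G]
    {A : G → Submodule ℂ L} (hA : IsGroupGrading A) {x : L} (hx : x ≠ 0) {g g' : G}
    (hg : x ∈ A g) (hg' : x ∈ A g') : g = g' := by
  by_contra hne
  exact hx (Submodule.disjoint_def.1
    (hA.isInternal.submodule_iSupIndep.pairwiseDisjoint hne) x hg hg')

end LieSuperalgebra

/-! ### Coordinates, radical and center of the twisted Heisenberg superalgebra -/

namespace TwistedHeisenberg

open LieSuperalgebra

variable {k r m : ℕ} {lam : Fin k → ℂ} {kap : Fin r → ℂ}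

/-- The indices of the standard basis as a sum of finite types. -/
def indexEquiv (k r d : ℕ) :
    TwistedIndex k r d ≃ Unit ⊕ Unit ⊕ (Fin k ⊕ Fin k) ⊕ (Fin r ⊕ Fin r) ⊕ Fin d where
  toFun
    | .z => .inl ()
    | .u => .inr (.inl ())
    | .e i => .inr (.inr (.inl (.inl i)))
    | .eHat i => .inr (.inr (.inl (.inr i)))
    | .w i => .inr (.inr (.inr (.inl (.inl i))))
    | .wHat i => .inr (.inr (.inr (.inl (.inr i))))
    | .eta i => .inr (.inr (.inr (.inr i)))
  invFun
    | .inl () => .z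
    | .inr (.inl ()) => .u
    | .inr (.inr (.inl (.inl i))) => .e i
    | .inr (.inr (.inl (.inr i))) => .eHat i
    | .inr (.inr (.inr (.inl (.inl i)))) => .w i
    | .inr (.inr (.inr (.inl (.inr i)))) => .wHat i
    | .inr (.inr (.inr (.inr i))) => .eta i
  left_inv a := by cases a <;> rfl
  right_inv a := by rcases a with a | a | (a | a) | (a | a) | a <;> rfl

instance (d : ℕ) : Finite (TwistedIndex k r d) := Finite.of_equiv _ (indexEquiv k r d).symm

/-- The standard basis. -/
def stdBasis : Module.Basis (TwistedIndex k r (m - 2 * r)) ℂ (TwistedHeisenberg k r m lam kap) :=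
  (Finsupp.basisSingleOne : Module.Basis _ ℂ (TwistedIndex k r (m - 2 * r) →₀ ℂ))

theorem stdBasis_apply (a : TwistedIndex k r (m - 2 * r)) : (stdBasis a : TwistedHeisenberg k r m lam kap) = std a :=
  congrFun Finsupp.coe_basisSingleOne a

instance : FiniteDimensional ℂ (TwistedHeisenberg k r m lam kap) := Module.Basis.finiteDimensional_of_finite stdBasis

theorem finrank_eq (hm : 2 * r ≤ m) : Module.finrank ℂ (TwistedHeisenberg k r m lam kap) = 2 * k + 2 + m := by
  rw [Module.finrank_eq_nat_card_basis (stdBasis (lam := lam) (kap := kap)),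
    Nat.card_congr (indexEquiv k r _)]
  simp
  omega

/-- The coordinates with respect to the standard basis. -/
def coord (a : TwistedIndex k r (m - 2 * r)) : (TwistedHeisenberg k r m lam kap) →ₗ[ℂ] ℂ := stdBasis.coord a

open Classical in
theorem coord_std (a b : TwistedIndex k r (m - 2 * r)) :
    coord a (std b : TwistedHeisenberg k r m lam kap) = if b = a then 1 else 0 := by
  rw [coord, ← stdBasis_apply, Module.Basis.coord_apply, Module.Basis.repr_self,
    Finsupp.single_apply]

theorem hom_ext {N : Type*} [AddCommGroup N] [Module ℂ N] {f g : (TwistedHeisenberg k r m lam kap) →ₗ[ℂ] N}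
    (h : ∀ a, f (std a) = g (std a)) : f = g :=
  stdBasis.ext fun a => by rw [stdBasis_apply]; exact h a

theorem sum_coord (x : TwistedHeisenberg k r m lam kap) [Fintype (TwistedIndex k r (m - 2 * r))] :
    ∑ a, coord a x • std a = x := by
  conv_rhs => rw [← stdBasis.sum_repr x]
  simp [coord, stdBasis_apply]

end TwistedHeisenberg

theorem LieSuperalgebra.even_bracket_self {L : Type*} [AddCommGroup L] [Module ℂ L]
    [LieSuperalgebra L] {u : L} (hu : u ∈ evenPart L) : bracketHom u u = 0 := by
  have := skew hu hu
  simp only [parSign, zero_ne_one, and_self, if_false, one_smul] at this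
  rw [eq_neg_iff_add_eq_zero, ← two_smul ℂ] at this
  exact (smul_eq_zero.1 this).resolve_left two_ne_zero

namespace TwistedHeisenberg

open LieSuperalgebra

variable {k r m : ℕ} {lam : Fin k → ℂ} {kap : Fin r → ℂ}

/-- Bracketing with the partner of a basis vector reads off its coordinate. This lemma and its
analogues below determine the radical of the Heisenberg ideal and the center. -/
theorem coord_z_brac_eHat (i : Fin k) (x : TwistedHeisenberg k r m lam kap) :
    coord .z (brac x (std (.eHat i))) = lam i * coord (.e i) x := by
  have : coord .z ∘ₗ brac.flip (std (.eHat i)) =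
      lam i • (coord (.e i) : TwistedHeisenberg k r m lam kap →ₗ[ℂ] ℂ) := by
    refine hom_ext fun a => ?_
    cases a <;> simp [brac_std, table, coord_std] <;> split_ifs <;> simp_all [coord_std]
  exact congrArg (fun f => f x) this

theorem coord_z_brac_e (i : Fin k) (x : TwistedHeisenberg k r m lam kap) :
    coord .z (brac x (std (.e i))) = (-lam i) * coord (.eHat i) x := by
  have : coord .z ∘ₗ brac.flip (std (.e i)) =
      (-lam i) • (coord (.eHat i) : TwistedHeisenberg k r m lam kap →ₗ[ℂ] ℂ) := by
    refine hom_ext fun a => ?_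
    cases a <;> simp [brac_std, table, coord_std] <;> split_ifs <;> simp_all [coord_std]
  exact congrArg (fun f => f x) this

theorem coord_z_brac_w (i : Fin r) (x : TwistedHeisenberg k r m lam kap) :
    coord .z (brac x (std (.w i))) = (1 : ℂ) * coord (.w i) x := by
  have : coord .z ∘ₗ brac.flip (std (.w i)) =
      (1 : ℂ) • (coord (.w i) : TwistedHeisenberg k r m lam kap →ₗ[ℂ] ℂ) := by
    refine hom_ext fun a => ?_
    cases a <;> simp [brac_std, table, coord_std] <;> split_ifs <;> simp_all [coord_std]
  exact congrArg (fun f => f x) this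

theorem coord_z_brac_wHat (i : Fin r) (x : TwistedHeisenberg k r m lam kap) :
    coord .z (brac x (std (.wHat i))) = (1 : ℂ) * coord (.wHat i) x := by
  have : coord .z ∘ₗ brac.flip (std (.wHat i)) =
      (1 : ℂ) • (coord (.wHat i) : TwistedHeisenberg k r m lam kap →ₗ[ℂ] ℂ) := by
    refine hom_ext fun a => ?_
    cases a <;> simp [brac_std, table, coord_std] <;> split_ifs <;> simp_all [coord_std]
  exact congrArg (fun f => f x) this

theorem coord_z_brac_eta (i : Fin (m - 2 * r)) (x : TwistedHeisenberg k r m lam kap) :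
    coord .z (brac x (std (.eta i))) = (1 : ℂ) * coord (.eta i) x := by
  have : coord .z ∘ₗ brac.flip (std (.eta i)) =
      (1 : ℂ) • (coord (.eta i) : TwistedHeisenberg k r m lam kap →ₗ[ℂ] ℂ) := by
    refine hom_ext fun a => ?_
    cases a <;> simp [brac_std, table, coord_std] <;> split_ifs <;> simp_all [coord_std]
  exact congrArg (fun f => f x) this

theorem coord_eHat_brac_e (i : Fin k) (x : TwistedHeisenberg k r m lam kap) :
    coord (.eHat i) (brac x (std (.e i))) = lam i * coord .u x := by
  have : coord (.eHat i) ∘ₗ brac.flip (std (.e i)) =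
      lam i • (coord .u : TwistedHeisenberg k r m lam kap →ₗ[ℂ] ℂ) := by
    refine hom_ext fun a => ?_
    cases a <;> simp [brac_std, table, coord_std] <;> split_ifs <;> simp_all [coord_std]
  exact congrArg (fun f => f x) this

theorem coord_wHat_brac_w (i : Fin r) (x : TwistedHeisenberg k r m lam kap) :
    coord (.wHat i) (brac x (std (.w i))) = kap i * coord .u x := by
  have : coord (.wHat i) ∘ₗ brac.flip (std (.w i)) =
      kap i • (coord .u : TwistedHeisenberg k r m lam kap →ₗ[ℂ] ℂ) := by
    refine hom_ext fun a => ?_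
    cases a <;> simp [brac_std, table, coord_std] <;> split_ifs <;> simp_all [coord_std]
  exact congrArg (fun f => f x) this

theorem coord_u_brac (x y : TwistedHeisenberg k r m lam kap) : coord .u (brac x y) = 0 := by
  have : (brac : TwistedHeisenberg k r m lam kap →ₗ[ℂ] _ →ₗ[ℂ] (TwistedHeisenberg k r m lam kap)).compr₂ (coord .u) = 0 := by
    refine hom_ext fun a => hom_ext fun b => ?_
    cases a <;> cases b <;> simp [brac_std, table, coord_std] <;> split_ifs <;> simp [coord_std]
  exact congrArg (fun f => f x y) this

theorem coord_u_odd {x : TwistedHeisenberg k r m lam kap} (hx : x ∈ oddPart (TwistedHeisenberg k r m lam kap)) : coord .u x = 0 := by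
  have : oddPart (TwistedHeisenberg k r m lam kap) ≤ LinearMap.ker (coord .u) := by
    refine Submodule.span_le.2 ?_
    rintro _ ⟨a, ha, rfl⟩
    change coord .u (std a) = 0
    rw [coord_std, if_neg]
    rintro rfl
    exact zero_ne_one (α := ZMod 2) ha
  exact this hx

theorem mem_span_of_coord_u {x : TwistedHeisenberg k r m lam kap} (hx : coord .u x = 0) :
    x ∈ Submodule.span ℂ (Set.range fun a : {a : TwistedIndex k r (m - 2 * r) // a ≠ .u} =>
      (std a.1 : TwistedHeisenberg k r m lam kap)) := by
  classical
  have := Fintype.ofFinite (TwistedIndex k r (m - 2 * r))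
  rw [← sum_coord x]
  refine Submodule.sum_mem _ fun a _ => ?_
  by_cases ha : a = .u
  · rw [ha, hx, zero_smul]; exact Submodule.zero_mem _
  · exact Submodule.smul_mem _ _ (Submodule.subset_span ⟨⟨a, ha⟩, rfl⟩)

/-- The Heisenberg ideal has its derived algebra in the center. -/
theorem brac_mem_span_z {x y : TwistedHeisenberg k r m lam kap} (hx : coord .u x = 0) (hy : coord .u y = 0) :
    brac x y ∈ Submodule.span ℂ {(std .z : TwistedHeisenberg k r m lam kap)} := by
  have hz : ∀ c : ℂ, c • (std .z : TwistedHeisenberg k r m lam kap) ∈ Submodule.span ℂ {(std .z : TwistedHeisenberg k r m lam kap)} :=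
    fun c => Submodule.smul_mem _ _ (Submodule.mem_span_singleton_self _)
  have hz' := Submodule.mem_span_singleton_self (R := ℂ) (std .z : TwistedHeisenberg k r m lam kap)
  replace hx := mem_span_of_coord_u hx
  replace hy := mem_span_of_coord_u hy
  induction hx, hy using Submodule.span_induction₂ with
  | mem_mem x y hx hy =>
    obtain ⟨⟨a, ha⟩, rfl⟩ := hx
    obtain ⟨⟨b, hb⟩, rfl⟩ := hy
    rw [brac_std]
    cases a <;> cases b <;> simp [table] at ha hb ⊢ <;> split_ifs <;> simp [hz, hz']
  | zero_left => simp
  | zero_right => simp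
  | add_left _ _ _ _ _ _ h1 h2 => simpa using Submodule.add_mem _ h1 h2
  | add_right _ _ _ _ _ _ h1 h2 => simpa using Submodule.add_mem _ h1 h2
  | smul_left c _ _ _ _ h => simpa using Submodule.smul_mem _ c h
  | smul_right c _ _ _ _ h => simpa using Submodule.smul_mem _ c h

theorem brac_eq {x y : TwistedHeisenberg k r m lam kap} (hx : coord .u x = 0) (hy : coord .u y = 0) :
    brac x y = coord .z (brac x y) • std .z := by
  obtain ⟨c, hc⟩ := Submodule.mem_span_singleton.1 (brac_mem_span_z hx hy)
  rw [← hc, map_smul, coord_std, if_pos rfl, smul_eq_mul, mul_one]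

theorem eq_smul_z_of_radical (hlam : ∀ i, lam i ≠ 0) {x : TwistedHeisenberg k r m lam kap} (hx : coord .u x = 0)
    (h : ∀ y, coord .u y = 0 → brac x y = 0) : x = coord .z x • std .z := by
  classical
  have := Fintype.ofFinite (TwistedIndex k r (m - 2 * r))
  conv_lhs => rw [← sum_coord x]
  refine Finset.sum_eq_single _ (fun a _ ha => ?_) fun h => absurd (Finset.mem_univ _) h
  have hstd : ∀ b : TwistedIndex k r (m - 2 * r), b ≠ .u → brac x (std b) = 0 := fun b hb =>
    h _ (by rw [coord_std, if_neg hb])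
  have : coord a x = 0 := by
    cases a with
    | z => exact absurd rfl ha
    | u => exact hx
    | e i => simpa [hstd, hlam] using coord_z_brac_eHat i x
    | eHat i => simpa [hstd, hlam] using coord_z_brac_e i x
    | w i => simpa [hstd, eq_comm] using coord_z_brac_w i x
    | wHat i => simpa [hstd, eq_comm] using coord_z_brac_wHat i x
    | eta i => simpa [hstd, eq_comm] using coord_z_brac_eta i x
  rw [this, zero_smul]

theorem coord_u_eq_zero_of_brac (hkr : 0 < k + r) (hlam : ∀ i, lam i ≠ 0) (hkap : ∀ j, kap j ≠ 0)
    {x : TwistedHeisenberg k r m lam kap} (hx : ∀ y, brac x y = 0) : coord .u x = 0 := by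
  -- Some basis vector moved by ad u₀ is needed to detect the `u₀`-coordinate: an e_i if k > 0,
  -- otherwise a w_j.
  rcases Nat.eq_zero_or_pos k with hk | hk
  · simpa [hx, hkap] using coord_wHat_brac_w ⟨0, by omega⟩ x
  · simpa [hx, hlam] using coord_eHat_brac_e ⟨0, hk⟩ x

theorem center_eq (hkr : 0 < k + r) (hlam : ∀ i, lam i ≠ 0) (hkap : ∀ j, kap j ≠ 0) {x : TwistedHeisenberg k r m lam kap}
    (hx : x ∈ center (TwistedHeisenberg k r m lam kap)) : x = coord .z x • std .z :=
  eq_smul_z_of_radical hlam (coord_u_eq_zero_of_brac hkr hlam hkap hx) fun y _ => hx y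

theorem eq_top_of_std_mem {M : Submodule ℂ (TwistedHeisenberg k r m lam kap)} {u : TwistedHeisenberg k r m lam kap} (hu : coord .u u = 1) (huM : u ∈ M)
    (hM : ∀ a, a ≠ .u → (std a : TwistedHeisenberg k r m lam kap) ∈ M) : M = ⊤ := by
  rw [eq_top_iff]
  intro x _
  have h1 : x - coord .u x • u ∈ M := by
    have : coord .u (x - coord .u x • u) = 0 := by simp [hu]
    exact Submodule.span_le.2 (by rintro _ ⟨a, rfl⟩; exact hM a.1 a.2) (mem_span_of_coord_u this)
  rw [← sub_add_cancel x (coord .u x • u)]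
  exact Submodule.add_mem _ h1 (Submodule.smul_mem _ _ huM)

section derivation

variable {u : TwistedHeisenberg k r m lam kap} (hu : coord .u u = 1) (hue : u ∈ evenPart (TwistedHeisenberg k r m lam kap))

include hu in
-- u - u₀ lies in the Heisenberg ideal, whose brackets are multiples of z₀.
theorem brac_sub_mem {x : TwistedHeisenberg k r m lam kap} (hx : coord .u x = 0) :
    brac u x - brac (std .u) x ∈ Submodule.span ℂ {(std .z : TwistedHeisenberg k r m lam kap)} := by
  rw [← LinearMap.sub_apply, ← map_sub]
  exact brac_mem_span_z (by simp [hu, coord_std]) hx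

include hu hue in
-- The difference is a multiple of the even vector z₀ and is also odd.
theorem brac_eq_of_odd {x : TwistedHeisenberg k r m lam kap} (hx : x ∈ oddPart (TwistedHeisenberg k r m lam kap)) : brac u x = brac (std .u) x := by
  have h0 : Submodule.span ℂ {(std .z : TwistedHeisenberg k r m lam kap)} ≤
      evenPart (TwistedHeisenberg k r m lam kap) :=
    (Submodule.span_singleton_le_iff_mem _ _).2 (std_mem rfl)
  have h1 : brac u x ∈ oddPart (TwistedHeisenberg k r m lam kap) := even_bracket_mem hue hx
  have h2 : brac (std .u) x ∈ oddPart (TwistedHeisenberg k r m lam kap) :=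
    even_bracket_mem (std_mem rfl) hx
  exact sub_eq_zero.1 (eq_zero_of_mem_even_of_mem_odd (h0 (brac_sub_mem hu (coord_u_odd hx)))
    (Submodule.sub_mem _ h1 h2))

theorem brac_z (x : TwistedHeisenberg k r m lam kap) : brac x (std .z) = 0 := by
  have : brac.flip (std .z : TwistedHeisenberg k r m lam kap) = 0 := by
    refine hom_ext fun a => ?_
    cases a <;> simp [brac_std, table]
  exact congrArg (fun f => f x) this

end derivation

end TwistedHeisenberg

/-! ### Diagonalization of ad u -/

namespace TwistedHeisenberg

open LieSuperalgebra

variable {k r m : ℕ} {lam : Fin k → ℂ} {kap : Fin r → ℂ}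

section derivation

variable {u : TwistedHeisenberg k r m lam kap} (hu : coord .u u = 1) (hue : u ∈ evenPart (TwistedHeisenberg k r m lam kap))

theorem signedScalars_ne_zero (hlam : ∀ i, lam i ≠ 0) (hkap : ∀ j, kap j ≠ 0) :
    ∀ α ∈ signedScalars lam kap, α ≠ 0 := by
  rintro α (⟨i, rfl | rfl⟩ | ⟨j, rfl | rfl⟩)
  · exact hlam i
  · exact neg_ne_zero.2 (hlam i)
  · exact hkap j
  · exact neg_ne_zero.2 (hkap j)

include hu in
/-- An eigenvector of `ad u₀` lies in the sum of the eigenspaces of `ad u`. -/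
theorem mem_iSup_eigenspace {E : Set ℂ} (hE : (0 : ℂ) ∈ E) {ν : ℂ} (hν : ν ∈ E) (hν0 : ν ≠ 0)
    {v : TwistedHeisenberg k r m lam kap} (hv : coord .u v = 0) (h : brac (std .u) v = ν • v) :
    v ∈ ⨆ ν ∈ E, Module.End.eigenspace (brac u) ν := by
  obtain ⟨c, hc⟩ := Submodule.mem_span_singleton.1 (brac_sub_mem hu hv)
  have h0 : (std .z : TwistedHeisenberg k r m lam kap) ∈ Module.End.eigenspace (brac u) 0 := by
    rw [Module.End.mem_eigenspace_iff, brac_z, zero_smul]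
  -- Here [u, v] = νv + cz₀. As z₀ is killed by ad u, adding ν⁻¹cz₀ to v absorbs the error term.
  have h1 : v + (ν⁻¹ * c) • std .z ∈ Module.End.eigenspace (brac u) ν := by
    rw [Module.End.mem_eigenspace_iff, map_add, map_smul, brac_z, smul_zero, add_zero, smul_add,
      smul_smul, mul_inv_cancel_left₀ hν0, ← h, hc, add_sub_cancel]
  rw [← add_sub_cancel_right v ((ν⁻¹ * c) • std .z)]
  exact Submodule.sub_mem _ (Submodule.mem_iSup_of_mem ν (Submodule.mem_iSup_of_mem hν h1))
    (Submodule.smul_mem _ _ (Submodule.mem_iSup_of_mem 0 (Submodule.mem_iSup_of_mem hE h0)))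

include hu in
-- a + ib and a - ib are eigenvectors of ad u₀ with eigenvalues -iα and iα, and they span a and b.
theorem mem_iSup_eigenspace_of_rotation {E : Set ℂ} (hE : (0 : ℂ) ∈ E) {α : ℂ} (hα0 : α ≠ 0)
    (hα : -Complex.I * α ∈ E) (hα' : -Complex.I * -α ∈ E) {a b : TwistedHeisenberg k r m lam kap} (ha : coord .u a = 0)
    (hb : coord .u b = 0) (hab : brac (std .u) a = α • b) (hba : brac (std .u) b = -(α • a)) :
    a ∈ ⨆ ν ∈ E, Module.End.eigenspace (brac u) ν ∧
      b ∈ ⨆ ν ∈ E, Module.End.eigenspace (brac u) ν := by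
  have h1 : a + Complex.I • b ∈ ⨆ ν ∈ E, Module.End.eigenspace (brac u) ν := by
    refine mem_iSup_eigenspace hu hE hα (by simp [hα0]) (by simp [ha, hb]) ?_
    rw [map_add, map_smul, hab, hba]
    match_scalars
    · linear_combination α * Complex.I_sq
    · ring
  have h2 : a - Complex.I • b ∈ ⨆ ν ∈ E, Module.End.eigenspace (brac u) ν := by
    refine mem_iSup_eigenspace hu hE hα' (by simp [hα0]) (by simp [ha, hb]) ?_
    rw [map_sub, map_smul, hab, hba]
    match_scalars
    · linear_combination α * Complex.I_sq
    · ring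
  have h3 : a = (1 / 2 : ℂ) • ((a + Complex.I • b) + (a - Complex.I • b)) := by module
  have h4 : b = (-Complex.I / 2 : ℂ) • ((a + Complex.I • b) - (a - Complex.I • b)) := by
    match_scalars
    · linear_combination Complex.I_sq
    · ring
  exact ⟨h3 ▸ Submodule.smul_mem _ _ (Submodule.add_mem _ h1 h2),
    h4 ▸ Submodule.smul_mem _ _ (Submodule.sub_mem _ h1 h2)⟩

include hu hue in
/-- The derivation `ad u` is diagonalizable. -/
theorem iSup_eigenspace_eq_top (hlam : ∀ i, lam i ≠ 0) (hkap : ∀ j, kap j ≠ 0) :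
    ⨆ ν ∈ insert (0 : ℂ) ((fun α => -Complex.I * α) '' signedScalars lam kap),
      Module.End.eigenspace (brac u) ν = ⊤ := by
  obtain ⟨E, hE⟩ : ∃ E, E = insert (0 : ℂ) ((fun α => -Complex.I * α) '' signedScalars lam kap) :=
    ⟨_, rfl⟩
  have h0 : (0 : ℂ) ∈ E := hE ▸ Set.mem_insert _ _
  have hα : ∀ α ∈ signedScalars lam kap, -Complex.I * α ∈ E :=
    fun α h => hE ▸ Set.mem_insert_of_mem _ ⟨α, h, rfl⟩
  have hker : ∀ v : TwistedHeisenberg k r m lam kap, brac u v = 0 → v ∈ ⨆ ν ∈ E, Module.End.eigenspace (brac u) ν :=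
    fun v hv => Submodule.mem_iSup_of_mem 0 (Submodule.mem_iSup_of_mem h0 (by
      rw [Module.End.mem_eigenspace_iff, hv, zero_smul]))
  rw [← hE]
  have he := fun i : Fin k => mem_iSup_eigenspace_of_rotation (a := std (.e i))
    (b := std (.eHat i)) hu h0 (hlam i) (hα _ (Or.inl ⟨i, Or.inl rfl⟩))
    (hα _ (Or.inl ⟨i, Or.inr rfl⟩)) (by simp [coord_std]) (by simp [coord_std])
    (by rw [brac_std]; rfl) (by rw [brac_std]; rfl)
  have hw := fun i : Fin r => mem_iSup_eigenspace_of_rotation (a := std (.w i))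
    (b := std (.wHat i)) hu h0 (hkap i) (hα _ (Or.inr ⟨i, Or.inl rfl⟩))
    (hα _ (Or.inr ⟨i, Or.inr rfl⟩)) (by simp [coord_std]) (by simp [coord_std])
    (by rw [brac_std]; rfl) (by rw [brac_std]; rfl)
  refine eq_top_of_std_mem hu (hker u (even_bracket_self hue)) fun a ha => ?_
  cases a with
  | z => exact hker _ (brac_z _)
  | u => exact absurd rfl ha
  | e i => exact (he i).1
  | eHat i => exact (he i).2
  | w i => exact (hw i).1
  | wHat i => exact (hw i).2
  | eta i =>
    refine hker _ ?_
    rw [brac_eq_of_odd hu hue (std_mem rfl), brac_std]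
    rfl

include hu in
/-- The algebra is spanned by `z`, `u`, the image of `ad u` and the odd part. -/
theorem eq_top_of_range_le (hlam : ∀ i, lam i ≠ 0) {M : Submodule ℂ (TwistedHeisenberg k r m lam kap)} (huM : u ∈ M)
    (hz : std .z ∈ M) (hodd : oddPart (TwistedHeisenberg k r m lam kap) ≤ M) (hrange : LinearMap.range (brac u) ≤ M) :
    M = ⊤ := by
  have hspan : Submodule.span ℂ {(std .z : TwistedHeisenberg k r m lam kap)} ≤ M := (Submodule.span_singleton_le_iff_mem _ _).2 hz
  have hD : ∀ v : TwistedHeisenberg k r m lam kap, coord .u v = 0 → brac (std .u) v ∈ M := fun v hv => by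
    rw [← sub_sub_cancel (brac u v) (brac (std .u) v)]
    exact Submodule.sub_mem _ (hrange ⟨v, rfl⟩) (hspan (brac_sub_mem hu hv))
  refine eq_top_of_std_mem hu huM fun a ha => ?_
  cases a with
  | z => exact hz
  | u => exact absurd rfl ha
  | e i =>
    have := hD (std (.eHat i)) (by simp [coord_std])
    rw [brac_std] at this
    exact (Submodule.smul_mem_iff _ (hlam i)).1 ((Submodule.neg_mem_iff _).1 this)
  | eHat i =>
    have := hD (std (.e i)) (by simp [coord_std])
    rw [brac_std] at this
    exact (Submodule.smul_mem_iff _ (hlam i)).1 this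
  | w i => exact hodd (std_mem rfl)
  | wHat i => exact hodd (std_mem rfl)
  | eta i => exact hodd (std_mem rfl)

include hu in
theorem brac_ne_zero (hkr : 0 < k + r) (hlam : ∀ i, lam i ≠ 0) (hkap : ∀ j, kap j ≠ 0) :
    brac u ≠ 0 := by
  intro h
  have := coord_u_eq_zero_of_brac hkr hlam hkap (x := u) fun y => by rw [h]; rfl
  exact one_ne_zero (hu.symm.trans this)

end derivation

theorem exists_homogeneous_u {G : Type*} [AddCommGroup G] [DecidableEq G]
    {A : G → Submodule ℂ (TwistedHeisenberg k r m lam kap)} (hA : IsGroupGrading A) :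
    ∃ (h : G) (u : TwistedHeisenberg k r m lam kap), u ∈ A h ∧ u ∈ evenPart (TwistedHeisenberg k r m lam kap) ∧ coord .u u = 1 := by
  by_contra! hcon
  have h1 : evenPart (TwistedHeisenberg k r m lam kap) ≤ LinearMap.ker (coord .u) := by
    refine (hA.part_le_span 0).trans (Submodule.span_le.2 ?_)
    rintro x ⟨hx, g, hg⟩
    by_contra hx0
    exact hcon g ((coord .u x)⁻¹ • x) (Submodule.smul_mem _ _ hg) (Submodule.smul_mem _ _ hx)
      (by rw [map_smul, smul_eq_mul, inv_mul_cancel₀ hx0])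
  have h2 : coord .u (std .u : TwistedHeisenberg k r m lam kap) = 0 := h1 (std_mem rfl)
  simp [coord_std] at h2

end TwistedHeisenberg

/-! ### The block space as an instance of the abstract setting -/

namespace TwistedHeisenberg

open LieSuperalgebra

variable {k r m : ℕ} {lam : Fin k → ℂ} {kap : Fin r → ℂ}

/-- The complement of the span of `z` and `u` on which the blocks live. -/
def blockSpace (u : TwistedHeisenberg k r m lam kap) : Submodule ℂ (TwistedHeisenberg k r m lam kap) := LinearMap.range (brac u) ⊔ oddPart (TwistedHeisenberg k r m lam kap)

variable {u : TwistedHeisenberg k r m lam kap} (hu : coord .u u = 1) (hue : u ∈ evenPart (TwistedHeisenberg k r m lam kap))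

theorem coord_u_blockSpace {x : TwistedHeisenberg k r m lam kap} (hx : x ∈ blockSpace u) : coord .u x = 0 := by
  have : blockSpace u ≤ LinearMap.ker (coord .u) := by
    refine sup_le ?_ fun x hx => coord_u_odd hx
    rintro _ ⟨y, rfl⟩
    exact coord_u_brac u y
  exact this hx

theorem brac_mem_blockSpace (x : TwistedHeisenberg k r m lam kap) : brac u x ∈ blockSpace u :=
  Submodule.mem_sup_left ⟨x, rfl⟩

include hu hue in
theorem iSup_eigenspace (hlam : ∀ i, lam i ≠ 0) (hkap : ∀ j, kap j ≠ 0) :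
    ⨆ ν, Module.End.eigenspace (brac u) ν = ⊤ := by
  rw [eq_top_iff, ← iSup_eigenspace_eq_top hu hue hlam hkap]
  exact iSup₂_le fun ν _ => le_iSup (Module.End.eigenspace (brac u)) ν

include hu hue in
-- An even vector of the block space is [u, y₀] with y₀ even, since its odd contributions cancel;
-- kernel and range of the diagonalizable ad u meet in 0.
theorem eq_zero_of_even_of_brac_eq_zero (hlam : ∀ i, lam i ≠ 0) (hkap : ∀ j, kap j ≠ 0) {x : TwistedHeisenberg k r m lam kap}
    (hx : x ∈ blockSpace u) (hxe : x ∈ evenPart (TwistedHeisenberg k r m lam kap)) (h : brac u x = 0) : x = 0 := by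
  obtain ⟨_, ⟨y, rfl⟩, o, ho, rfl⟩ := Submodule.mem_sup.1 hx
  obtain ⟨y0, hy0, y1, hy1, rfl⟩ := exists_even_add_odd y
  have h0 : brac u y0 ∈ evenPart (TwistedHeisenberg k r m lam kap) := even_bracket_mem hue hy0
  have h1 : brac u y1 ∈ oddPart (TwistedHeisenberg k r m lam kap) := even_bracket_mem hue hy1
  have h2 : brac u y1 + o = 0 := by
    refine eq_zero_of_mem_even_of_mem_odd ?_ (Submodule.add_mem _ h1 ho)
    rw [map_add, add_assoc] at hxe
    simpa using Submodule.sub_mem _ hxe h0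
  have heq : brac u (y0 + y1) + o = brac u y0 := by rw [map_add, add_assoc, h2, add_zero]
  rw [heq] at h ⊢
  exact Submodule.disjoint_def.1 (Module.End.disjoint_ker_range_of_iSup_eigenspace
    (iSup_eigenspace hu hue hlam hkap)) _ (LinearMap.mem_ker.2 h) ⟨y0, rfl⟩

include hu hue in
theorem eq_zero_of_smul_z_mem (hlam : ∀ i, lam i ≠ 0) (hkap : ∀ j, kap j ≠ 0) {c : ℂ}
    (h : c • (std .z : TwistedHeisenberg k r m lam kap) ∈ blockSpace u) : c • (std .z : TwistedHeisenberg k r m lam kap) = 0 :=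
  eq_zero_of_even_of_brac_eq_zero hu hue hlam hkap h (Submodule.smul_mem _ _ (std_mem rfl))
    (by rw [map_smul, brac_z, smul_zero])

include hu in
theorem exists_decomposition (hlam : ∀ i, lam i ≠ 0) (x : TwistedHeisenberg k r m lam kap) :
    ∃ a b : ℂ, ∃ v ∈ blockSpace u, x = a • std .z + b • u + v := by
  have : Submodule.span ℂ {(std .z : TwistedHeisenberg k r m lam kap)} ⊔ Submodule.span ℂ {u} ⊔ blockSpace u = ⊤ := by
    refine eq_top_of_range_le hu hlam ?_ ?_ ?_ ?_
    · exact Submodule.mem_sup_left (Submodule.mem_sup_right (Submodule.mem_span_singleton_self _))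
    · exact Submodule.mem_sup_left (Submodule.mem_sup_left (Submodule.mem_span_singleton_self _))
    · exact le_sup_right.trans le_sup_right
    · exact le_sup_left.trans le_sup_right
  obtain ⟨y, hy, v, hv, rfl⟩ := Submodule.mem_sup.1 (this ▸ Submodule.mem_top (x := x))
  obtain ⟨y0, hy0, y1, hy1, rfl⟩ := Submodule.mem_sup.1 hy
  obtain ⟨a, rfl⟩ := Submodule.mem_span_singleton.1 hy0
  obtain ⟨b, rfl⟩ := Submodule.mem_span_singleton.1 hy1
  exact ⟨a, b, v, hv, rfl⟩

include hu hue in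
-- The Heisenberg ideal is the block space plus the line of z₀, and this line is its radical. The
-- line meets the block space only in 0.
theorem blockSpace_nondegenerate (hlam : ∀ i, lam i ≠ 0) (hkap : ∀ j, kap j ≠ 0) {x : TwistedHeisenberg k r m lam kap}
    (hx : x ∈ blockSpace u) (h : ∀ y ∈ blockSpace u, brac x y = 0) : x = 0 := by
  have hxz : x = coord .z x • std .z := by
    refine eq_smul_z_of_radical hlam (coord_u_blockSpace hx) fun y hy => ?_
    obtain ⟨a, b, v, hv, rfl⟩ := exists_decomposition hu hlam y
    have hb : b = 0 := by
      simpa [coord_std, hu, coord_u_blockSpace hv] using hy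
    rw [hb, zero_smul, add_zero, map_add, map_smul, brac_z, smul_zero, zero_add, h v hv]
  rw [hxz] at hx ⊢
  exact eq_zero_of_smul_z_mem hu hue hlam hkap hx

include hu in
theorem blockSpace_ne_bot (hkr : 0 < k + r) (hlam : ∀ i, lam i ≠ 0) (hkap : ∀ j, kap j ≠ 0) :
    blockSpace u ≠ ⊥ := fun h => brac_ne_zero hu hkr hlam hkap <| by
  ext1 x
  exact (Submodule.mem_bot ℂ).1 (h ▸ brac_mem_blockSpace x)

section grading

variable {G : Type*} [AddCommGroup G] [DecidableEq G] {A : G → Submodule ℂ (TwistedHeisenberg k r m lam kap)}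
    (hA : IsGroupGrading A) {h : G} (huh : u ∈ A h)

include hA huh in
theorem brac_mem_grading {g : G} {x : TwistedHeisenberg k r m lam kap} (hx : x ∈ A g) : brac u x ∈ A (h + g) :=
  hA.bracket_mem huh hx

include hA huh in
theorem brac_pow_mem_grading {g : G} {x : TwistedHeisenberg k r m lam kap} (hx : x ∈ A g) (n : ℕ) :
    ((brac u : Module.End ℂ (TwistedHeisenberg k r m lam kap)) ^ n) x ∈ A (n • h + g) := by
  induction n with
  | zero => simpa using hx
  | succ n ih =>
    rw [pow_succ', Module.End.mul_apply, succ_nsmul', add_assoc]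
    exact brac_mem_grading hA huh ih

include hA huh hue in
theorem blockSpace_le_span : blockSpace u ≤
    Submodule.span ℂ {x | x ∈ blockSpace u ∧ ∃ g a, x ∈ A g ∧ x ∈ (part a : Submodule ℂ (TwistedHeisenberg k r m lam kap))} := by
  obtain ⟨N, hN⟩ : ∃ N : Submodule ℂ (TwistedHeisenberg k r m lam kap), N = Submodule.span ℂ
      {x | x ∈ blockSpace u ∧ ∃ g a, x ∈ A g ∧ x ∈ (part a : Submodule ℂ (TwistedHeisenberg k r m lam kap))} := ⟨_, rfl⟩
  rw [← hN]
  have key : ∀ a, (part a : Submodule ℂ (TwistedHeisenberg k r m lam kap)) ≤ N.comap (brac u) := fun a => by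
    refine (hA.part_le_span a).trans (Submodule.span_le.2 ?_)
    rintro x ⟨hx, g, hg⟩
    rw [hN]
    exact Submodule.subset_span ⟨brac_mem_blockSpace x, h + g, a, brac_mem_grading hA huh hg,
      even_bracket_mem hue hx⟩
  refine sup_le ?_ ((hA.part_le_span 1).trans (Submodule.span_le.2 ?_))
  · rintro _ ⟨y, rfl⟩
    obtain ⟨y0, hy0, y1, hy1, rfl⟩ := exists_even_add_odd y
    rw [map_add]
    exact Submodule.add_mem _ (key 0 hy0) (key 1 hy1)
  · rintro x ⟨hx, g, hg⟩
    rw [hN]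
    exact Submodule.subset_span ⟨Submodule.mem_sup_right hx, g, 1, hg, hx⟩

include hA huh hue hu in
-- If h had infinite order, the degrees n • h + g would be distinct, so one of them would be missing
-- from the finite support and a power of ad u would kill each homogeneous vector. Diagonalizability
-- then makes ad u vanish on its own range, hence everywhere.
theorem addOrderOf_pos (hkr : 0 < k + r) (hlam : ∀ i, lam i ≠ 0) (hkap : ∀ j, kap j ≠ 0) :
    0 < addOrderOf h := by
  rw [addOrderOf_pos_iff]
  by_contra hh
  have hdiag := iSup_eigenspace hu hue hlam hkap
  have hfin : {g | A g ≠ ⊥}.Finite :=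
    WellFoundedGT.finite_ne_bot_of_iSupIndep hA.isInternal.submodule_iSupIndep
  have hinj := injective_nsmul_iff_not_isOfFinAddOrder.2 hh
  have hker : blockSpace u ≤ LinearMap.ker (brac u) := by
    refine (blockSpace_le_span hue hA huh).trans (Submodule.span_le.2 ?_)
    rintro x ⟨-, g, a, hg, -⟩
    obtain ⟨n, hn⟩ : ∃ n : ℕ, A (n • h + g) = ⊥ := by
      by_contra! hcon
      have hinj' : Function.Injective fun n : ℕ => n • h + g :=
        fun a b hab => hinj (add_right_cancel hab)
      exact Set.infinite_range_of_injective hinj' (hfin.subset (by rintro _ ⟨n, rfl⟩; exact hcon n))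
    have hx0 := brac_pow_mem_grading hA huh hg n
    rw [hn, Submodule.mem_bot] at hx0
    exact Module.End.apply_eq_zero_of_pow_apply_eq_zero hdiag hx0
  refine brac_ne_zero hu hkr hlam hkap ?_
  ext1 x
  exact Submodule.disjoint_def.1 (Module.End.disjoint_ker_range_of_iSup_eigenspace hdiag) _
    (hker (brac_mem_blockSpace x)) ⟨x, rfl⟩

include hA huh hue hu in
-- By nondegeneracy two homogeneous vectors have a nonzero multiple of z₀ as bracket, so z₀ is
-- homogeneous.
theorem exists_degree_z (hkr : 0 < k + r) (hlam : ∀ i, lam i ≠ 0) (hkap : ∀ j, kap j ≠ 0) :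
    ∃ g, (std .z : TwistedHeisenberg k r m lam kap) ∈ A g := by
  obtain ⟨x, ⟨hx, g, -, hg, -⟩, y, ⟨hy, g', -, hg', -⟩, hxy⟩ :=
    exists_ne_zero_of_nondegenerate (ω := (brac : (TwistedHeisenberg k r m lam kap) →ₗ[ℂ] (TwistedHeisenberg k r m lam kap) →ₗ[ℂ] (TwistedHeisenberg k r m lam kap)).compr₂ (coord .z))
      (blockSpace_ne_bot hu hkr hlam hkap)
      (fun x hx h => blockSpace_nondegenerate hu hue hlam hkap hx fun y hy => by
        rw [brac_eq (coord_u_blockSpace hx) (coord_u_blockSpace hy)]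
        rw [show coord .z (brac x y) = 0 from h y hy, zero_smul])
      (fun _ h => h.1) (blockSpace_le_span hue hA huh)
  refine ⟨g + g', (Submodule.smul_mem_iff _ hxy).1 ?_⟩
  have := hA.bracket_mem hg hg'
  change brac x y ∈ _ at this
  rwa [brac_eq (coord_u_blockSpace hx) (coord_u_blockSpace hy)] at this

include hA huh hue hu in
-- Because l • h = 0, the operator T^l preserves each subspace of given degree and parity in V; a
-- diagonalizable operator stays diagonalizable on a stable subspace.
theorem blockSpace_le_span_component (hlam : ∀ i, lam i ≠ 0) (hkap : ∀ j, kap j ≠ 0) :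
    blockSpace u ≤ Submodule.span ℂ
      {x | x ∈ blockSpace u ∧ ∃ j, x ∈ component A u (addOrderOf h) j} := by
  refine (blockSpace_le_span hue hA huh).trans (Submodule.span_le.2 ?_)
  rintro x ⟨hx, g, a, hg, ha⟩
  obtain ⟨p, hp⟩ : ∃ p : Submodule ℂ (TwistedHeisenberg k r m lam kap), p = blockSpace u ⊓ A g ⊓ part a := ⟨_, rfl⟩
  have hstab : ∀ n, ∀ y ∈ blockSpace u, ((brac u : Module.End ℂ (TwistedHeisenberg k r m lam kap)) ^ n) y ∈ blockSpace u := by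
    intro n y hy
    induction n with
    | zero => simpa using hy
    | succ n ih => rw [pow_succ', Module.End.mul_apply]; exact brac_mem_blockSpace _
  have hstab' : ∀ n, ∀ y ∈ (part a : Submodule ℂ (TwistedHeisenberg k r m lam kap)),
      ((brac u : Module.End ℂ (TwistedHeisenberg k r m lam kap)) ^ n) y ∈ (part a : Submodule ℂ (TwistedHeisenberg k r m lam kap)) := by
    intro n y hy
    induction n with
    | zero => simpa using hy
    | succ n ih => rw [pow_succ', Module.End.mul_apply]; exact even_bracket_mem hue ih
  have hT : ∀ y ∈ p, ((brac u : Module.End ℂ (TwistedHeisenberg k r m lam kap)) ^ addOrderOf h) y ∈ p := by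
    rw [hp]
    rintro y ⟨⟨hy1, hy2⟩, hy3⟩
    refine ⟨⟨hstab _ y hy1, ?_⟩, hstab' _ y hy3⟩
    simpa [addOrderOf_nsmul_eq_zero] using brac_pow_mem_grading hA huh hy2 (addOrderOf h)
  have hinf := Submodule.inf_iSup_genEigenspace (p := p) hT 1
  have hx' : x ∈ p ⊓ ⨆ μ, Module.End.eigenspace ((brac u : Module.End ℂ (TwistedHeisenberg k r m lam kap)) ^ addOrderOf h) μ := by
    rw [Module.End.iSup_eigenspace_pow (iSup_eigenspace hu hue hlam hkap), hp]
    exact ⟨⟨⟨hx, hg⟩, ha⟩, Submodule.mem_top⟩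
  have hle : ⨆ μ, p ⊓ Module.End.eigenspace ((brac u : Module.End ℂ (TwistedHeisenberg k r m lam kap)) ^ addOrderOf h) μ ≤
      Submodule.span ℂ {x | x ∈ blockSpace u ∧ ∃ j, x ∈ component A u (addOrderOf h) j} := by
    refine iSup_le fun μ y hy => Submodule.subset_span ?_
    rw [hp] at hy
    exact ⟨hy.1.1.1, (g, a, μ), ⟨hy.1.1.2, hy.1.2⟩, hy.2⟩
  exact hle (hinf ▸ hx')

end grading

/-- The form on the block space with values measured in multiples of `c • z₀`. -/
def blockForm (c : ℂ) : (TwistedHeisenberg k r m lam kap) →ₗ[ℂ] (TwistedHeisenberg k r m lam kap) →ₗ[ℂ] ℂ := c⁻¹ • brac.compr₂ (coord .z)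

theorem brac_eq_blockForm {c : ℂ} (hc : c ≠ 0) {x y : TwistedHeisenberg k r m lam kap} (hx : x ∈ blockSpace u)
    (hy : y ∈ blockSpace u) : brac x y = blockForm c x y • (c • (std .z : TwistedHeisenberg k r m lam kap)) := by
  rw [brac_eq (coord_u_blockSpace hx) (coord_u_blockSpace hy), smul_smul]
  congr 1
  simp only [blockForm, LinearMap.smul_apply, LinearMap.compr₂_apply, smul_eq_mul]
  field_simp

include hu hue in
theorem blockSetting {G : Type*} [AddCommGroup G] [DecidableEq G] {A : G → Submodule ℂ (TwistedHeisenberg k r m lam kap)}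
    (hA : IsGroupGrading A) {h gz : G} (huh : u ∈ A h) (hz : (std .z : TwistedHeisenberg k r m lam kap) ∈ A gz)
    (hkr : 0 < k + r) (hlam : ∀ i, lam i ≠ 0) (hkap : ∀ j, kap j ≠ 0) {c : ℂ} (hc : c ≠ 0) :
    BlockSetting A (c • (std .z : TwistedHeisenberg k r m lam kap)) u h gz (addOrderOf h) (signedScalars lam kap)
      (blockSpace u) (blockForm c) where
  z_even := Submodule.smul_mem _ _ (std_mem rfl)
  u_even := hue
  z_ne := smul_ne_zero hc fun h => by
    have := congrArg (coord .z) h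
    simp [coord_std] at this
  u_z := by
    change brac u _ = 0
    rw [map_smul, brac_z, smul_zero]
  l_pos := addOrderOf_pos hu hue hA huh hkr hlam hkap
  order := rfl
  scal_ne := signedScalars_ne_zero hlam hkap
  T_mem x _ := brac_mem_blockSpace x
  T_deg g x hx := brac_mem_grading hA huh hx
  lie_eq x hx y hy := brac_eq_blockForm hc hx hy
  ω_deg g g' x hx y hy hxg hyg hω := by
    have := hA.bracket_mem hxg hyg
    change brac x y ∈ _ at this
    rw [brac_eq_blockForm hc hx hy, Submodule.smul_mem_iff _ hω, Submodule.smul_mem_iff _ hc] at this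
    refine hA.eq_of_mem (fun h => ?_) this hz
    have := congrArg (coord .z) h
    simp [coord_std] at this
  T_ker x hx hxe h := eq_zero_of_even_of_brac_eq_zero hu hue hlam hkap hx hxe h
  -- For ν = 0 only T^l x = 0 is immediate; diagonalizability improves it to Tx = 0.
  T_pow x _ hx0 μ hμ := by
    obtain ⟨ν, hν, rfl⟩ := Module.End.exists_eq_pow_of_pow_apply
      (iSup_eigenspace_eq_top hu hue hlam hkap) hx0 hμ
    rcases hν with rfl | ⟨α, hα, rfl⟩
    · left
      rw [zero_pow (addOrderOf_pos hu hue hA huh hkr hlam hkap).ne', zero_smul] at hμ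
      exact Module.End.apply_eq_zero_of_pow_apply_eq_zero (iSup_eigenspace hu hue hlam hkap) hμ
    · exact Or.inr ⟨α, hα, rfl⟩

include hu hue in
theorem isSplit_blockSpace {G : Type*} [AddCommGroup G] [DecidableEq G] {A : G → Submodule ℂ (TwistedHeisenberg k r m lam kap)}
    (hA : IsGroupGrading A) {h : G} (huh : u ∈ A h)
    (hlam : ∀ i, lam i ≠ 0) (hkap : ∀ j, kap j ≠ 0) {c : ℂ} (hc : c ≠ 0) :
    IsSplit A u (addOrderOf h) (blockSpace u) (blockForm c) (blockSpace u) where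
  le := le_rfl
  le_span := blockSpace_le_span_component hu hue hA huh hlam hkap
  T_mem x _ := brac_mem_blockSpace x
  nondeg x hx h := blockSpace_nondegenerate hu hue hlam hkap hx fun y hy => by
    rw [brac_eq_blockForm hc hx hy, h y hy, zero_smul]

end TwistedHeisenberg

/-! ### Sorting the blocks by type -/

theorem exists_enumeration {ι β γ : Type*} [Finite ι] (B : ι → β) (F : γ → β) :
    ∃ (t : ℕ) (D : Fin t → γ) (f : Fin t → ι), Function.Injective f ∧
      (∀ j, B (f j) = F (D j)) ∧ ∀ i c, B i = F c → ∃ j, f j = i := by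
  have e := Finite.equivFin {i // ∃ c, B i = F c}
  refine ⟨_, fun j => (e.symm j).2.choose, fun j => (e.symm j).1,
    Subtype.val_injective.comp e.symm.injective, fun j => (e.symm j).2.choose_spec,
    fun i c h => ⟨e ⟨i, c, h⟩, by simp⟩⟩

namespace LieSuperalgebra

variable {L : Type*} [AddCommGroup L] [Module ℂ L] [LieSuperalgebra L]

theorem dualFamily_sigma {κ : Type*} {ι : κ → Type*} {b : (Σ c, ι c) → L}
    (h1 : ∀ c, DualFamily fun i => b ⟨c, i⟩) (h2 : ∀ a a', a.1 ≠ a'.1 → ⁅b a, b a'⁆ = 0) :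
    DualFamily b := by
  rintro ⟨c, i⟩
  obtain ⟨j, hj, hj'⟩ := h1 c i
  refine ⟨⟨c, j⟩, hj, ?_⟩
  rintro ⟨c', i'⟩ hi'
  by_cases hc : c' = c
  · subst hc
    exact hj' i' fun h => hi' (h ▸ rfl)
  · exact h2 ⟨c', i'⟩ ⟨c, j⟩ hc

/-- The indices of the elements of all blocks as a sum of finite types. -/
def blockIndexEquiv (l t t' q q' s p : ℕ) :
    (Σ c : BlockLabel t t' q q', c.Index l s p) ≃
      Fin t × (Fin l ⊕ Fin l) ⊕ Fin t' × (Fin l ⊕ Fin l) ⊕ Fin q × Fin (2 * (l / 2)) ⊕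
        Fin q' × Fin (2 * (l / 2)) ⊕ ((Fin s ⊕ Fin s) ⊕ Fin p) where
  toFun
    | ⟨.evenI j, i⟩ => .inl (j, i)
    | ⟨.oddI j, i⟩ => .inr (.inl (j, i))
    | ⟨.evenII j, i⟩ => .inr (.inr (.inl (j, i)))
    | ⟨.oddII j, i⟩ => .inr (.inr (.inr (.inl (j, i))))
    | ⟨.typeIII, i⟩ => .inr (.inr (.inr (.inr i)))
  invFun
    | .inl (j, i) => ⟨.evenI j, i⟩
    | .inr (.inl (j, i)) => ⟨.oddI j, i⟩
    | .inr (.inr (.inl (j, i))) => ⟨.evenII j, i⟩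
    | .inr (.inr (.inr (.inl (j, i)))) => ⟨.oddII j, i⟩
    | .inr (.inr (.inr (.inr i))) => ⟨.typeIII, i⟩
  left_inv := by rintro ⟨c | c | c | c | c, i⟩ <;> rfl
  right_inv := by rintro (⟨j, i⟩ | ⟨j, i⟩ | ⟨j, i⟩ | ⟨j, i⟩ | i) <;> rfl

/-- Blocks are collected according to their constructor; all pairs and single elements are merged
into one block of type III, whose mixed brackets vanish by orthogonality of the pieces. -/
theorem exists_block_families {z u : L} (hze : z ∈ evenPart L) (hue : u ∈ evenPart L) (hz : z ≠ 0)
    {l : ℕ} {Sc : Set ℂ} {ι : Type} [Finite ι] (B : ι → Block L l)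
    (hB : ∀ i, (B i).IsBlock z u Sc)
    (horth : ∀ i j, i ≠ j → ∀ x ∈ (B i).elems, ∀ y ∈ (B j).elems, ⁅x, y⁆ = 0) :
    ∃ (t t' q q' s p : ℕ) (β : Fin t → ℂ) (β' : Fin t' → ℂ) (α : Fin q → ℂ) (α' : Fin q' → ℂ)
      (X : Fin t → Fin l ⊕ Fin l → L) (X' : Fin t' → Fin l ⊕ Fin l → L)
      (Y : Fin q → Fin (2 * (l / 2)) → L) (Y' : Fin q' → Fin (2 * (l / 2)) → L)
      (T : (Fin s ⊕ Fin s) ⊕ Fin p → L),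
      (Odd l → q = 0 ∧ q' = 0) ∧
      (∀ j, β j ∈ Sc) ∧ (∀ j, β' j ∈ Sc) ∧ (∀ j, α j ∈ Sc) ∧ (∀ j, α' j ∈ Sc) ∧
      (∀ j, IsEvenBlockI z u l (β j) (X j)) ∧
      (∀ j, IsOddBlockI z u l (β' j) (X' j)) ∧
      (∀ j, IsEvenBlockII z u (l / 2) (α j) (Y j)) ∧
      (∀ j, IsOddBlockII z u (l / 2) (α' j) (Y' j)) ∧
      IsBlockIII z u s p T ∧
      (∀ a b, a.1 ≠ b.1 → ⁅blockUnion X X' Y Y' T a, blockUnion X X' Y Y' T b⁆ = 0) ∧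
      Set.range (blockUnion X X' Y Y' T) = {x | ∃ i, x ∈ (B i).elems} := by
  obtain ⟨t, D1, f1, hf1, h1, c1⟩ := exists_enumeration B Block.evenI
  obtain ⟨t', D2, f2, hf2, h2, c2⟩ := exists_enumeration B Block.oddI
  obtain ⟨q, D3, f3, hf3, h3, c3⟩ := exists_enumeration B Block.evenII
  obtain ⟨q', D4, f4, hf4, h4, c4⟩ := exists_enumeration B Block.oddII
  obtain ⟨s, D5, f5, hf5, h5, c5⟩ := exists_enumeration B Block.pair
  obtain ⟨p, D6, f6, hf6, h6, c6⟩ := exists_enumeration B Block.single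
  have b1 := fun j => hB (f1 j)
  have b2 := fun j => hB (f2 j)
  have b3 := fun j => hB (f3 j)
  have b4 := fun j => hB (f4 j)
  have b5 := fun j => hB (f5 j)
  have b6 := fun j => hB (f6 j)
  simp only [h1, h2, h3, h4, h5, h6, Block.IsBlock] at b1 b2 b3 b4 b5 b6
  obtain ⟨T, hT⟩ : ∃ T : (Fin s ⊕ Fin s) ⊕ Fin p → L,
      T = Sum.elim (Sum.elim (fun i => (D5 i).1) fun i => (D5 i).2) D6 := ⟨_, rfl⟩
  -- `own c i` says that the i-th block contributes to the label `c`. Each i belongs to at most one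
  -- label, which turns a difference of labels into a difference of indices.
  obtain ⟨own, hown⟩ : ∃ own : BlockLabel t t' q q' → ι → Prop, own = fun c i =>
      match c with
      | .evenI j => i = f1 j
      | .oddI j => i = f2 j
      | .evenII j => i = f3 j
      | .oddII j => i = f4 j
      | .typeIII => (∃ j, i = f5 j) ∨ ∃ j, i = f6 j := ⟨_, rfl⟩
  have hTown : ∀ a, ∃ i, ((∃ j, i = f5 j) ∨ ∃ j, i = f6 j) ∧ T a ∈ (B i).elems := by
    rintro ((j | j) | j)
    · exact ⟨f5 j, Or.inl ⟨j, rfl⟩, by rw [h5, hT]; exact Or.inl rfl⟩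
    · exact ⟨f5 j, Or.inl ⟨j, rfl⟩, by rw [h5, hT]; exact Or.inr rfl⟩
    · exact ⟨f6 j, Or.inr ⟨j, rfl⟩, by rw [h6, hT]; exact rfl⟩
  have hmem : ∀ a, ∃ i, own a.1 i ∧ blockUnion (fun j => (D1 j).2) (fun j => (D2 j).2)
      (fun j => (D3 j).2) (fun j => (D4 j).2) T a ∈ (B i).elems := by
    subst hown
    rintro ⟨j | j | j | j | _, i⟩
    · exact ⟨f1 j, rfl, by rw [h1]; exact ⟨i, rfl⟩⟩
    · exact ⟨f2 j, rfl, by rw [h2]; exact ⟨i, rfl⟩⟩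
    · exact ⟨f3 j, rfl, by rw [h3]; exact ⟨i, rfl⟩⟩
    · exact ⟨f4 j, rfl, by rw [h4]; exact ⟨i, rfl⟩⟩
    · exact hTown i
  have hdisj : ∀ c c' i, own c i → own c' i → c = c' := by
    subst hown
    rintro (j | j | j | j | _) (j' | j' | j' | j' | _) i hi hi' <;> dsimp only at hi hi'
    case evenI.evenI => rw [hf1 (hi.symm.trans hi')]
    case oddI.oddI => rw [hf2 (hi.symm.trans hi')]
    case evenII.evenII => rw [hf3 (hi.symm.trans hi')]
    case oddII.oddII => rw [hf4 (hi.symm.trans hi')]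
    case typeIII.typeIII => rfl
    -- For different labels of different types, the same block would carry two different
    -- constructors. A label of type III offers two constructors, hence the alternatives below.
    all_goals
      exfalso
      have e := congrArg B (rfl : i = i)
      first
      | (rcases hi with ⟨j, hi⟩ | ⟨j, hi⟩ <;>
          (conv_lhs at e => rw [hi]) <;> (conv_rhs at e => rw [hi']) <;>
          simp [h1, h2, h3, h4, h5, h6] at e)
      | (rcases hi' with ⟨j, hi'⟩ | ⟨j, hi'⟩ <;>
          (conv_lhs at e => rw [hi]) <;> (conv_rhs at e => rw [hi']) <;>
          simp [h1, h2, h3, h4, h5, h6] at e)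
      | ((conv_lhs at e => rw [hi]) ; (conv_rhs at e => rw [hi']) ;
          simp [h1, h2, h3, h4] at e)
  have hodd : ∀ i, T i ∈ oddPart L := by
    rw [hT]
    rintro ((j | j) | j)
    · exact (b5 j).1
    · exact (b5 j).2.1
    · exact (b6 j).1
  have p_q : ∀ i j, ⁅T (.inl (.inl i)), T (.inl (.inr j))⁆ = if i = j then z else 0 := by
    intro i j
    rw [hT]
    split_ifs with hij
    · subst hij; exact (b5 i).2.2.2.2.1
    · exact horth (f5 i) (f5 j) (fun h => hij (hf5 h)) _ (by rw [h5]; exact Or.inl rfl) _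
        (by rw [h5]; exact Or.inr rfl)
  have p_p : ∀ i j, ⁅T (.inl (.inl i)), T (.inl (.inl j))⁆ = 0 := by
    intro i j
    rw [hT]
    by_cases hij : i = j
    · subst hij; exact (b5 i).2.2.2.2.2.1
    · exact horth (f5 i) (f5 j) (fun h => hij (hf5 h)) _ (by rw [h5]; exact Or.inl rfl) _
        (by rw [h5]; exact Or.inl rfl)
  have q_q : ∀ i j, ⁅T (.inl (.inr i)), T (.inl (.inr j))⁆ = 0 := by
    intro i j
    rw [hT]
    by_cases hij : i = j
    · subst hij; exact (b5 i).2.2.2.2.2.2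
    · exact horth (f5 i) (f5 j) (fun h => hij (hf5 h)) _ (by rw [h5]; exact Or.inr rfl) _
        (by rw [h5]; exact Or.inr rfl)
  have pq_z : ∀ i j, ⁅T (.inl i), T (.inr j)⁆ = 0 := by
    have hne : ∀ i j, f5 i ≠ f6 j := fun i j h => by
      have := congrArg B h
      simp [h5, h6] at this
    rw [hT]
    rintro (i | i) j
    · exact horth (f5 i) (f6 j) (hne i j) _ (by rw [h5]; exact Or.inl rfl) _
        (by rw [h6]; exact rfl)
    · exact horth (f5 i) (f6 j) (hne i j) _ (by rw [h5]; exact Or.inr rfl) _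
        (by rw [h6]; exact rfl)
  have z_z : ∀ i j, ⁅T (.inr i), T (.inr j)⁆ = if i = j then z else 0 := by
    intro i j
    rw [hT]
    split_ifs with hij
    · subst hij; exact (b6 i).2.2
    · exact horth (f6 i) (f6 j) (fun h => hij (hf6 h)) _ (by rw [h6]; exact rfl) _
        (by rw [h6]; exact rfl)
  have u_b : ∀ i, ⁅u, T i⁆ = 0 := by
    rw [hT]
    rintro ((j | j) | j)
    · exact (b5 j).2.2.1
    · exact (b5 j).2.2.2.1
    · exact (b6 j).2.1
  refine ⟨t, t', q, q', s, p, fun j => (D1 j).1, fun j => (D2 j).1, fun j => (D3 j).1,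
    fun j => (D4 j).1, fun j => (D1 j).2, fun j => (D2 j).2, fun j => (D3 j).2, fun j => (D4 j).2,
    T, fun hl => ⟨?_, ?_⟩, fun j => (b1 j).1, fun j => (b2 j).1, fun j => (b3 j).2.1,
    fun j => (b4 j).2.1, fun j => (b1 j).2, fun j => (b2 j).2, fun j => (b3 j).2.2,
    fun j => (b4 j).2.2, ⟨hze, hue, hodd,
      (dualFamily_blockIII hz hodd p_q p_p q_q pq_z z_z).linearIndependent, u_b, p_q, p_p, q_q,
      pq_z, z_z⟩, ?_, ?_⟩
  · by_contra hq
    exact Nat.not_even_iff_odd.2 hl (b3 ⟨0, Nat.pos_of_ne_zero hq⟩).1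
  · by_contra hq
    exact Nat.not_even_iff_odd.2 hl (b4 ⟨0, Nat.pos_of_ne_zero hq⟩).1
  · intro a b hab
    obtain ⟨i, hi, hia⟩ := hmem a
    obtain ⟨j, hj, hjb⟩ := hmem b
    exact horth i j (fun h => hab (hdisj _ _ i hi (h ▸ hj))) _ hia _ hjb
  · ext x
    constructor
    · rintro ⟨a, rfl⟩
      obtain ⟨i, -, hi⟩ := hmem a
      exact ⟨i, hi⟩
    · rintro ⟨i, hi⟩
      rcases hBi : B i with d | d | d | d | d | y
      · obtain ⟨j, rfl⟩ := c1 i d hBi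
        rw [h1] at hi
        obtain ⟨n, rfl⟩ := hi
        exact ⟨⟨.evenI j, n⟩, rfl⟩
      · obtain ⟨j, rfl⟩ := c2 i d hBi
        rw [h2] at hi
        obtain ⟨n, rfl⟩ := hi
        exact ⟨⟨.oddI j, n⟩, rfl⟩
      · obtain ⟨j, rfl⟩ := c3 i d hBi
        rw [h3] at hi
        obtain ⟨n, rfl⟩ := hi
        exact ⟨⟨.evenII j, n⟩, rfl⟩
      · obtain ⟨j, rfl⟩ := c4 i d hBi
        rw [h4] at hi
        obtain ⟨n, rfl⟩ := hi
        exact ⟨⟨.oddII j, n⟩, rfl⟩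
      · obtain ⟨j, rfl⟩ := c5 i d hBi
        rw [h5] at hi
        rcases hi with rfl | rfl
        · exact ⟨⟨.typeIII, .inl (.inl j)⟩, by rw [hT]; rfl⟩
        · exact ⟨⟨.typeIII, .inl (.inr j)⟩, by rw [hT]; rfl⟩
      · obtain ⟨j, rfl⟩ := c6 i y hBi
        rw [h6] at hi
        obtain rfl := hi
        exact ⟨⟨.typeIII, .inr j⟩, by rw [hT]; rfl⟩

end LieSuperalgebra

end
-- The structure theorem
open LieSuperalgebra in
theorem mainTheorem3 (k r m : ℕ) (hm : 2 * r ≤ m) (hkr : 0 < k + r)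
    (lam : Fin k → ℂ) (kap : Fin r → ℂ) (hlam : ∀ i, lam i ≠ 0) (hkap : ∀ j, kap j ≠ 0)
    {G : Type*} [AddCommGroup G] [DecidableEq G]
    (A : G → Submodule ℂ (TwistedHeisenberg k r m lam kap)) (hA : IsGroupGrading A)
    (z : TwistedHeisenberg k r m lam kap)
    (hz : z ∈ center (TwistedHeisenberg k r m lam kap)) (hz0 : z ≠ 0) :
    ∃ (u : TwistedHeisenberg k r m lam kap) (h : G) (l t t' q q' s p : ℕ)
      (β : Fin t → ℂ) (β' : Fin t' → ℂ) (α : Fin q → ℂ) (α' : Fin q' → ℂ)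
      (X : Fin t → Fin l ⊕ Fin l → TwistedHeisenberg k r m lam kap)
      (X' : Fin t' → Fin l ⊕ Fin l → TwistedHeisenberg k r m lam kap)
      (Y : Fin q → Fin (2 * (l / 2)) → TwistedHeisenberg k r m lam kap)
      (Y' : Fin q' → Fin (2 * (l / 2)) → TwistedHeisenberg k r m lam kap)
      (T : (Fin s ⊕ Fin s) ⊕ Fin p → TwistedHeisenberg k r m lam kap),
      -- `u` is homogeneous of degree `h`, and `l` is the (finite) order of `h`
      u ∈ A h ∧ 0 < l ∧ addOrderOf h = l ∧
      -- with `n = 2k + 1`: `l (q + q' + 2t + 2t') + 2s + p = n + m - 1`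
      l * (q + q' + 2 * t + 2 * t') + 2 * s + p + 1 = (2 * k + 1) + m ∧
      (Odd l → q = 0 ∧ q' = 0) ∧
      (∀ j, β j ∈ signedScalars lam kap) ∧ (∀ j, β' j ∈ signedScalars lam kap) ∧
      (∀ j, α j ∈ signedScalars lam kap) ∧ (∀ j, α' j ∈ signedScalars lam kap) ∧
      (∀ j, IsEvenBlockI z u l (β j) (X j)) ∧
      (∀ j, IsOddBlockI z u l (β' j) (X' j)) ∧
      (∀ j, IsEvenBlockII z u (l / 2) (α j) (Y j)) ∧
      (∀ j, IsOddBlockII z u (l / 2) (α' j) (Y' j)) ∧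
      IsBlockIII z u s p T ∧
      -- brackets between different blocks vanish
      (∀ a b, a.1 ≠ b.1 → ⁅blockUnion X X' Y Y' T a, blockUnion X X' Y Y' T b⁆ = 0) ∧
      -- `{z, u}` and the blocks form a basis of homogeneous elements
      LinearIndependent ℂ (Sum.elim ![z, u] (blockUnion X X' Y Y' T)) ∧
      Submodule.span ℂ (Set.range (Sum.elim ![z, u] (blockUnion X X' Y Y' T))) = ⊤ ∧
      ∀ a, ∃ g, Sum.elim ![z, u] (blockUnion X X' Y Y' T) a ∈ A g := by
  classical
  obtain ⟨h, u, huh, hue, hu⟩ := TwistedHeisenberg.exists_homogeneous_u hA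
  obtain ⟨gz, hgz⟩ := TwistedHeisenberg.exists_degree_z hu hue hA huh hkr hlam hkap
  obtain ⟨c, rfl⟩ : ∃ c : ℂ, z = c • TwistedHeisenberg.std .z :=
    ⟨_, TwistedHeisenberg.center_eq hkr hlam hkap hz⟩
  have hc : c ≠ 0 := by rintro rfl; simp at hz0
  have S := TwistedHeisenberg.blockSetting hu hue hA huh hgz hkr hlam hkap hc
  obtain ⟨Bs, hBs, hpair, hspan⟩ := S.exists_blocks _
    (TwistedHeisenberg.isSplit_blockSpace hu hue hA huh hlam hkap hc)
  have hel : ∀ (i : Fin Bs.length), ∀ x ∈ (Bs.get i).elems,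
      x ∈ TwistedHeisenberg.blockSpace u ∧ ∃ j, x ∈ component A u (addOrderOf h) j := fun i x hx =>
    ⟨((hBs _ (Bs.get_mem i)).2 x hx).1, ((hBs _ (Bs.get_mem i)).2 x hx).2.1⟩
  have horth : ∀ i j : Fin Bs.length, i ≠ j → ∀ x ∈ (Bs.get i).elems,
      ∀ y ∈ (Bs.get j).elems, ⁅x, y⁆ = 0 := by
    have hlt : ∀ i j : Fin Bs.length, i < j → ∀ x ∈ (Bs.get i).elems,
        ∀ y ∈ (Bs.get j).elems, ⁅y, x⁆ = 0 := by
      intro i j hij x hx y hy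
      rw [lie_eq_bracketHom, S.lie_eq y (hel j y hy).1 x (hel i x hx).1,
        List.pairwise_iff_get.1 hpair i j hij x hx y hy, zero_smul]
    -- The list gives orthogonality in one order only; super skew-symmetry, applied to vectors of
    -- definite parity, supplies the other.
    intro i j hij x hx y hy
    rcases lt_or_gt_of_ne hij with hij | hij
    · obtain ⟨a, ha⟩ := (hel i x hx).2
      obtain ⟨b, hb⟩ := (hel j y hy).2
      exact lie_eq_zero_symm hb.1.2 ha.1.2 (hlt i j hij x hx y hy)
    · exact hlt j i hij y hy x hx
  obtain ⟨t, t', q, q', s, p, β, β', α, α', X, X', Y, Y', T, hq, hβ, hβ', hα, hα', hX, hX', hY,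
    hY', hT, hcross, hrange⟩ := exists_block_families S.z_even hue hz0 Bs.get
      (fun i => (hBs _ (Bs.get_mem i)).1) horth
  have hdual : DualFamily (blockUnion X X' Y Y' T) := by
    refine dualFamily_sigma ?_ hcross
    rintro (j | j | j | j | _)
    · exact (hX j).dualFamily hz0
    · exact (hX' j).dualFamily hz0
    · exact (hY j).dualFamily hz0
    · exact (hY' j).dualFamily hz0
    · exact dualFamily_blockIII hz0 hT.odd hT.p_q hT.p_p hT.q_q hT.pq_z hT.z_z
  have hmem : ∀ a, ∃ i, blockUnion X X' Y Y' T a ∈ (Bs.get i).elems := fun a =>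
    (Set.ext_iff.1 hrange _).1 ⟨a, rfl⟩
  have hle : Submodule.span ℂ (Set.range (blockUnion X X' Y Y' T)) ≤
      TwistedHeisenberg.blockSpace u := by
    rw [Submodule.span_le]
    rintro _ ⟨a, rfl⟩
    obtain ⟨i, hi⟩ := hmem a
    exact (hel i _ hi).1
  have hge : TwistedHeisenberg.blockSpace u ≤
      Submodule.span ℂ (Set.range (blockUnion X X' Y Y' T)) := by
    refine hspan.trans (Submodule.span_mono ?_)
    rw [hrange]
    rintro x ⟨B, hB, hx⟩
    obtain ⟨i, rfl⟩ := List.get_of_mem hB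
    exact ⟨i, hx⟩
  -- ⟨z, u⟩ meets the block space trivially: the `u₀`-coordinate removes u, and no nonzero multiple
  -- of z₀ lies there.
  have hzu : ∀ a b : ℂ, a • c • TwistedHeisenberg.std .z + b • u ∈
      TwistedHeisenberg.blockSpace u → a = 0 ∧ b = 0 := by
    intro a b hab
    have hb : b = 0 := by
      simpa [TwistedHeisenberg.coord_std, hu] using TwistedHeisenberg.coord_u_blockSpace hab
    refine ⟨?_, hb⟩
    rw [hb, zero_smul, add_zero, smul_smul] at hab
    have := TwistedHeisenberg.eq_zero_of_smul_z_mem hu hue hlam hkap hab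
    rw [← smul_smul] at this
    exact (smul_eq_zero.1 this).resolve_right hz0
  have hli : LinearIndependent ℂ (Sum.elim ![c • TwistedHeisenberg.std .z, u]
      (blockUnion X X' Y Y' T)) := by
    refine LinearIndependent.sum_type ?_ hdual.linearIndependent ?_
    · rw [LinearIndependent.pair_iff]
      intro a b hab
      exact hzu a b (hab ▸ Submodule.zero_mem _)
    · rw [Submodule.disjoint_def]
      intro x hx hx'
      rw [Matrix.range_cons, Matrix.range_cons, Matrix.range_empty, Set.union_empty,
        Set.singleton_union, Submodule.mem_span_pair] at hx
      obtain ⟨a, b, rfl⟩ := hx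
      obtain ⟨rfl, rfl⟩ := hzu a b (hle hx')
      simp
  have hsp : Submodule.span ℂ (Set.range (Sum.elim ![c • TwistedHeisenberg.std .z, u]
      (blockUnion X X' Y Y' T))) = ⊤ := by
    rw [eq_top_iff]
    intro x _
    obtain ⟨a, b, v, hv, rfl⟩ := TwistedHeisenberg.exists_decomposition hu hlam x
    refine Submodule.add_mem _ (Submodule.add_mem _ ?_ ?_) ?_
    · rw [← mul_inv_cancel_right₀ hc a, mul_right_comm, mul_smul]
      exact Submodule.smul_mem _ _ (Submodule.subset_span ⟨.inl 0, rfl⟩)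
    · exact Submodule.smul_mem _ _ (Submodule.subset_span ⟨.inl 1, rfl⟩)
    · refine Submodule.span_mono ?_ (hge hv)
      rintro _ ⟨a, rfl⟩
      exact ⟨.inr a, rfl⟩
  refine ⟨u, h, addOrderOf h, t, t', q, q', s, p, β, β', α, α', X, X', Y, Y', T, huh, S.l_pos,
    rfl, ?_, hq, hβ, hβ', hα, hα', hX, hX', hY, hY', hT, hcross, hli, hsp, ?_⟩
  · have hcard := Module.finrank_eq_nat_card_basis (Module.Basis.mk hli hsp.ge)
    rw [TwistedHeisenberg.finrank_eq hm, Nat.card_congr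
      (Equiv.sumCongr (Equiv.refl _) (blockIndexEquiv (addOrderOf h) t t' q q' s p))] at hcard
    simp only [Nat.card_eq_fintype_card, Fintype.card_sum, Fintype.card_prod, Fintype.card_fin]
      at hcard
    generalize addOrderOf h = l at hq hcard ⊢
    -- For odd l the floor makes 2 * (l / 2) differ from l, but then there are no blocks of type II.
    have h2 : q * (2 * (l / 2)) = q * l ∧ q' * (2 * (l / 2)) = q' * l := by
      rcases Nat.even_or_odd l with hl | hl
      · rw [Nat.two_mul_div_two_of_even hl]
        exact ⟨rfl, rfl⟩
      · simp [hq hl]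
    rw [h2.1, h2.2] at hcard
    linarith
  · rintro (i | a)
    · fin_cases i
      · exact ⟨gz, Submodule.smul_mem _ _ hgz⟩
      · exact ⟨h, huh⟩
    · obtain ⟨i, hi⟩ := hmem a
      obtain ⟨j, hj⟩ := (hel i _ hi).2
      exact ⟨j.1, hj.1.1⟩
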